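/- **Setting.** Let $\bm x_1,\bm x_2,\dots\in\mathbb R^p$ ($p$ fixed) be given covariates, let $\varepsilon_1,\varepsilon_2,\dots$ be independent $\mathcal N(0,1)$ errors, and let $y_i=\mathbb 1(z_i>0)$ with $z_i=\alpha^*+\bm x_i^\top\bm\beta^*+\varepsilon_i$ (probit model). A model $k$ is a subset of $\{1,\dots,p\}$ with $p_k$ elements; $k^*=\{j:\beta^*_j\neq 0\}$ is the true model, and $\mathcal M$ is a finite collection of candidate models containing $k^*$. For sample size $n$, $\bm X_k$ is the $n\times p_k$ matrix of the covariates in $k$, each column centered by its sample mean. Under model $k$, with $\bm\theta=(\alpha,\bm\beta)$, the latent data are $z_i\mid\bm\theta\sim\mathcal N(\alpha+\bm x_{k,i}^\top\bm\beta,1)$ independently, where $\bm x_{k,i}^\top$ is the $i$th row of $\bm X_k$, and $p(y_i\mid z_i)=\mathbb 1(z_i>0)^{y_i}\mathbb 1(z_i\le 0)^{1-y_i}$. The prior is $p(\alpha)=c$ for a constant $c>0$ common to all models and $\bm\beta\sim\mathcal N(\bm 0,g(\bm X_k^\top\bm X_k)^{-1})$ with $g=n$. A *variational solution* for model $k$ (with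 $\bm X_k^\top\bm X_k$ invertible) is a fixed point of the mean-field coordinate-ascent updates: $q(\bm z)=\prod_i q(z_i)$, where $q(z_i)$ is $\mathcal N(\mu_i,1)$ truncated to $(0,\infty)$ if $y_i=1$ and to $(-\infty,0]$ if $y_i=0$, with $\mu_i=\mu_\alpha+\bm x_{k,i}^\top\bm\mu_\beta$; $q(\alpha)=\mathcal N(\mu_\alpha,1/n)$ with $\mu_\alpha=\frac1n\sum_i\hat z_i$; and $q(\bm\beta)=\mathcal N\bigl(\bm\mu_\beta,\tfrac{g}{1+g}(\bm X_k^\top\bm X_k)^{-1}\bigr)$ with $\bm\mu_\beta=\tfrac{g}{1+g}(\bm X_k^\top\bm X_k)^{-1}\bm X_k^\top\hat{\bm z}$, where $\hat z_i=\mathbb E_{q}[z_i]$. Put $\hat{\bm\theta}=(\mu_\alpha,\bm\mu_\beta)$, $q(\bm\theta)=q(\alpha)q(\bm\beta)$ and $$\mathrm{VBC}_k=-2\log p_{\mathrm{VBC},k}(\bm y),\qquad p_{\mathrm{VBC},k}(\bm y)=\frac{p(\bm y\mid\hat{\bm z})\,p(\hat{\bm z}\mid\hat{\bm\theta})\,p(\hat{\bm\theta})}{q(\hat{\bm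 z})\,q(\hat{\bm\theta})}.$$ **Assumptions.** (a) The squared covariates are uniformly integrable: for every $\delta>0$ there is $B$ with $\sum_{i\le n}\|\bm x_i\|^2\mathbb 1(\|\bm x_i\|^2>B)\le\delta n$ for all $n$. (b) For every $k\in\mathcal M$, the smallest eigenvalue of $\frac1n\bm X_{k\cup k^*}^\top\bm X_{k\cup k^*}$ is bounded away from zero for all large $n$. **Claim.** Model selection based on the VBC is asymptotically consistent in the probit model. More precisely: 1. For every $n$, every model $k$, all $\bm y\in\{0,1\}^n$ and all location parameters $(\mu_\alpha,\bm\mu_\beta)$, with $q(z_i)$ the above truncated Gaussian with location $\mu_i$ and $\hat z_i$ its mean, $$\frac{p(\bm y\mid\hat{\bm z})\,p(\hat{\bm z}\mid\hat{\bm\theta})}{q(\hat{\bm z})}=p(\bm y\mid\hat{\bm\theta})=\prod_{i}\Phi(\mu_i)^{y_i}\bigl(1-\Phi(\mu_i)\bigr)^{1-y_i}.$$ 2. For every $k\in\mathcal M$, $\log p_{\mathrm{VBC},k}(\bm y)=\log p(\bm y\mid\hat{\bm\theta}_k)-\frac{p_k+1}{2}\log n+O_p(1)$ as $n\to\infty$,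 at a variational solution, which exists with probability tending to one. 3. With probability tending to one as $n\to\infty$, every $k\in\mathcal M$ has exactly one variational solution and $k^*$ is the only minimizer of $\mathrm{VBC}_k$ over $k\in\mathcal M$; that is, $\Pr\{\arg\min_{k\in\mathcal M}\mathrm{VBC}_k=k^*\}\to 1$. -/

import Mathlib

open MeasureTheory ProbabilityTheory Filter Topology
open scoped Matrix NNReal

namespace ProbitVBC

noncomputable section

/-- The standard normal distribution function. -/
def Phi (t : ℝ) : ℝ := cdf (gaussianReal 0 1) t

/-- Density at `b` of the multivariate normal distribution with mean `m` and covariance `S`. -/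
def multiGaussianDensity {ι : Type} [Fintype ι] [DecidableEq ι]
    (m : ι → ℝ) (S : Matrix ι ι ℝ) (b : ι → ℝ) : ℝ :=
  (Real.sqrt ((2 * Real.pi) ^ Fintype.card ι * S.det))⁻¹ *
    Real.exp (-(1 / 2) * ((b - m) ⬝ᵥ (S⁻¹ *ᵥ (b - m))))

/-- The latent values compatible with a binary outcome: `z > 0` for outcome 1 (`true`),
`z ≤ 0` for outcome 0 (`false`). -/
def latentSet (y : Bool) : Set ℝ := if y then Set.Ioi 0 else Set.Iic 0

/-- `p(y_i | z_i)`: the deterministic probit link, an indicator. -/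
def linkLik (y : Bool) (z : ℝ) : ℝ := (latentSet y).indicator (fun _ => 1) z

/-- Density of the normal distribution with location `μ` and scale 1, truncated to the
half-line of latent values compatible with the outcome `y`. -/
def truncDensity (μ : ℝ) (y : Bool) (z : ℝ) : ℝ :=
  (latentSet y).indicator
    (fun z => gaussianPDFReal μ 1 z / (gaussianReal μ 1).real (latentSet y)) z

/-- Mean of that truncated normal distribution. -/
def truncMean (μ : ℝ) (y : Bool) : ℝ := ∫ z, z * truncDensity μ y z

section Regression

variable {n : ℕ} {ι : Type} [Fintype ι] [DecidableEq ι]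

/-- The linear predictor `α + x_iᵀ β`. -/
def linPred (X : Matrix (Fin n) ι ℝ) (a : ℝ) (b : ι → ℝ) (i : Fin n) : ℝ := a + (X *ᵥ b) i

/-- The probit likelihood `p(y | α, β)`, with the latent data integrated out. -/
def probitLik (X : Matrix (Fin n) ι ℝ) (y : Fin n → Bool) (a : ℝ) (b : ι → ℝ) : ℝ :=
  ∏ i, if y i then Phi (linPred X a b i) else 1 - Phi (linPred X a b i)

/-- `p(z | α, β)`: independent normal latent data with unit variance. -/
def latentDensity (X : Matrix (Fin n) ι ℝ) (a : ℝ) (b : ι → ℝ) (z : Fin n → ℝ) : ℝ :=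
  ∏ i, gaussianPDFReal (linPred X a b i) 1 (z i)

/-- `p(y | z)`. -/
def obsLik (y : Fin n → Bool) (z : Fin n → ℝ) : ℝ := ∏ i, linkLik (y i) (z i)

/-- Parameters of the variational factors `q(α) = N(muA, omA)` and `q(β) = N(muB, OmB)`.
They also determine `q(z)`, see `qz`. -/
structure VBParams (ι : Type) where
  /-- mean of `q(α)` -/
  muA : ℝ
  /-- variance of `q(α)` -/
  omA : ℝ≥0
  /-- mean vector of `q(β)` -/
  muB : ι → ℝ
  /-- covariance matrix of `q(β)` -/
  OmB : Matrix ι ι ℝ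

/-- The location parameter `μ_i = μ_α + x_iᵀ μ_β` of `q(z_i)`. -/
def loc (X : Matrix (Fin n) ι ℝ) (q : VBParams ι) : Fin n → ℝ := linPred X q.muA q.muB

/-- The variational density of the latent data: a product of unit-scale normal densities with
locations `μ_i`, each truncated to the half-line compatible with `y_i`. -/
def qz (X : Matrix (Fin n) ι ℝ) (y : Fin n → Bool) (q : VBParams ι) (z : Fin n → ℝ) : ℝ :=
  ∏ i, truncDensity (loc X q i) (y i) (z i)

/-- The variational expectation `ẑ` of the latent data (the vector `m` of the updates). -/
def zhat (X : Matrix (Fin n) ι ℝ) (y : Fin n → Bool) (q : VBParams ι) (i : Fin n) : ℝ :=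
  truncMean (loc X q i) (y i)

/-- `q(α) q(β)` as a density. -/
def qtheta (q : VBParams ι) (a : ℝ) (b : ι → ℝ) : ℝ :=
  gaussianPDFReal q.muA q.omA a * multiGaussianDensity q.muB q.OmB b

/-- The prior density: the improper flat prior `p(α) = c` on the intercept (`c` is an arbitrary
constant, the same for all models) and the `g`-prior `N(0, g (XᵀX)⁻¹)` on the coefficients. -/
def priorDensity (c g : ℝ) (X : Matrix (Fin n) ι ℝ) (b : ι → ℝ) : ℝ :=
  c * multiGaussianDensity 0 (g • (Xᵀ * X)⁻¹) b

/-- `q` is a mean-field variational solution for the probit model with a centered design `X` of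
full column rank: every factor equals its coordinate-ascent update given the others. -/
structure IsVBSolution (g : ℝ) (X : Matrix (Fin n) ι ℝ) (y : Fin n → Bool) (q : VBParams ι) :
    Prop where
  fullRank : IsUnit (Xᵀ * X).det
  muA_eq : q.muA = (∑ i, zhat X y q i) / n
  omA_eq : q.omA = (n : ℝ≥0)⁻¹
  muB_eq : q.muB = (g / (1 + g)) • ((Xᵀ * X)⁻¹ *ᵥ (Xᵀ *ᵥ zhat X y q))
  OmB_eq : q.OmB = (g / (1 + g)) • (Xᵀ * X)⁻¹

/-- `p_VBC(y) = p(y | ẑ) p(ẑ | θ̂) p(θ̂) / (q(ẑ) q(θ̂))`, where `θ̂ = (μ_α, μ_β)` is the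
variational expectation of `θ = (α, β)`. -/
def pVBC (c g : ℝ) (X : Matrix (Fin n) ι ℝ) (y : Fin n → Bool) (q : VBParams ι) : ℝ :=
  obsLik y (zhat X y q) * latentDensity X q.muA q.muB (zhat X y q) * priorDensity c g X q.muB /
    (qz X y q (zhat X y q) * qtheta q q.muA q.muB)

/-- The variational Bayes criterion. -/
def VBC (c g : ℝ) (X : Matrix (Fin n) ι ℝ) (y : Fin n → Bool) (q : VBParams ι) : ℝ :=
  -2 * Real.log (pVBC c g X y q)

end Regression

/-- The `n × p_k` design matrix of model `k` (a set of covariates): the included columns of the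
first `n` rows of the covariates, each centered by subtracting its mean. -/
def design {p : ℕ} (x : ℕ → Fin p → ℝ) (n : ℕ) (k : Finset (Fin p)) : Matrix (Fin n) k ℝ :=
  Matrix.of fun i j => x i j - (∑ l : Fin n, x l j) / n

/-- The first `n` binary outcomes `y_i = 1(z_i > 0)` with `z_i = α + x_iᵀ β + ε_i`. -/
def outcomes {p : ℕ} (x : ℕ → Fin p → ℝ) (a : ℝ) (b : Fin p → ℝ) (e : ℕ → ℝ) (n : ℕ) :
    Fin n → Bool :=
  fun i => decide (0 < a + ∑ j, x i j * b j + e i)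

/-- The set of minimizers of `V` over the collection `M`. -/
def argminSet {κ : Type} (M : Finset κ) (V : κ → ℝ) : Set κ :=
  {k | k ∈ M ∧ ∀ l ∈ M, V k ≤ V l}

end

end ProbitVBC

/-!
The truncated mean is `ẑ_i = μ_i + s φ(μ_i) / Φ(s μ_i)` with `s = ±1` the sign of the outcome
(`truncMean_eq`), that is, `μ_i` plus the score of the probit likelihood. Hence the coordinate-ascent
equations for the means are exactly the first order conditions for the log-likelihood penalized by
`‖X β‖² / (2 g)` (`isVBSolution_iff`), a strictly concave function: there is at most one variational
solution (`IsStationary.unique`), and any maximizer gives one. Since the density of `q(z)` is the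
latent density divided by the outcome probabilities, and the Gram determinants of the prior and of
`q(β)` cancel, the logarithm of `p_VBC` is the maximum of the penalized log-likelihood
minus `(p_k / 2) log (1 + n)` and terms common to all models (`log_pVBC`).

Everything then follows from one bound on the log-likelihood ratio against the truth, valid for all
parameters on the event that the score at the truth, in all centered covariates, is at most `C √n`.
At distance `N ≤ 1` from the truth, computed in the supermodel `k ∪ k₀`, the ratio is at most
`C √n N - κ n N²`, because `log Φ` is uniformly concave on compact sets and uniform integrability
leaves a nondegenerate Gram matrix after rows with large covariates are dropped
(`exists_bounded_rows_curvature`). Concavity alone extends this to all distances, also for models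
which do not contain the truth; no separate limit theory for misspecified models is needed. The bound
(`LogLikRatioBound`) gives three things:

* a maximizer exists, at a bounded distance from the truth, so its penalty is bounded;
* a model that contains `k₀` gains at most `C² / (4 κ)` in log-likelihood, less than the `log n`
  penalty on an additional parameter;
* a model that misses a coefficient stays at a fixed distance from the truth, and loses a multiple
  of `n`.

The event has probability close to one for large `C` by Chebyshev's inequality
(`exists_prob_scoreSq_le`), since the scores of the observations are independent, centered and have
bounded variance.
-/

namespace ProbitVBC

noncomputable section

/-! ### The standard normal distribution function -/

/-- The inverse Mills ratio `φ / Φ`, the derivative of `log Φ`. -/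
def mills (t : ℝ) : ℝ := gaussianPDFReal 0 1 t / Phi t

lemma continuous_gaussianPDFReal_one (μ : ℝ) : Continuous (gaussianPDFReal μ 1) := by
  rw [gaussianPDFReal_def]
  fun_prop

lemma Phi_eq_integral (t : ℝ) : Phi t = ∫ z in Set.Iic t, gaussianPDFReal 0 1 z := by
  rw [Phi, cdf_eq_real, measureReal_def, gaussianReal_apply_eq_integral _ one_ne_zero,
    ENNReal.toReal_ofReal]
  exact integral_nonneg fun z => gaussianPDFReal_nonneg _ _ _

lemma Phi_sub_eq_intervalIntegral (s t : ℝ) :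
    Phi t - Phi s = ∫ z in s..t, gaussianPDFReal 0 1 z := by
  rw [Phi_eq_integral, Phi_eq_integral, intervalIntegral.integral_Iic_sub_Iic]
  all_goals exact (integrable_gaussianPDFReal 0 1).integrableOn

lemma hasDerivAt_Phi (t : ℝ) : HasDerivAt Phi (gaussianPDFReal 0 1 t) t := by
  have h := ((continuous_gaussianPDFReal_one 0).integral_hasStrictDerivAt 0 t).hasDerivAt
  have h2 := h.const_add (Phi 0)
  refine h2.congr_of_eventuallyEq (Eventually.of_forall fun s => ?_)
  simp only [← Phi_sub_eq_intervalIntegral]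
  ring

lemma Phi_pos (t : ℝ) : 0 < Phi t := by
  rw [Phi_eq_integral, setIntegral_pos_iff_support_of_nonneg_ae
    (Eventually.of_forall fun z => gaussianPDFReal_nonneg _ _ _)
    (integrable_gaussianPDFReal 0 1).integrableOn]
  have : Function.support (gaussianPDFReal 0 1) = Set.univ :=
    Set.eq_univ_of_forall fun z => (gaussianPDFReal_pos 0 1 z one_ne_zero).ne'
  rw [this]
  simp

lemma Phi_neg (t : ℝ) : Phi (-t) = 1 - Phi t := by
  have := nullSingletonClass_gaussianReal (μ := 0) (v := 1) one_ne_zero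
  have h1 : Phi (-t) = (gaussianReal 0 1).real (Set.Ici t) := by
    have h : (gaussianReal 0 1).map (fun z => -z) = gaussianReal 0 1 := by
      simpa using gaussianReal_map_neg (μ := 0) (v := 1)
    rw [Phi, cdf_eq_real]
    conv_lhs => rw [← h]
    rw [map_measureReal_apply (by fun_prop) measurableSet_Iic]
    congr 1
    ext z
    simp
  rw [h1, Phi, cdf_eq_real, measureReal_congr (Ioi_ae_eq_Ici (a := t)).symm, ← Set.compl_Iic,
    probReal_compl_eq_one_sub measurableSet_Iic]

lemma Phi_le_one (t : ℝ) : Phi t ≤ 1 := cdf_le_one _ _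

lemma gaussianReal_real_Ioi (μ : ℝ) : (gaussianReal μ 1).real (Set.Ioi 0) = Phi μ := by
  have := nullSingletonClass_gaussianReal (μ := 0) (v := 1) one_ne_zero
  have h : (gaussianReal 0 1).map (fun z => μ - z) = gaussianReal μ 1 := by
    simpa using gaussianReal_map_const_sub (μ := 0) (v := 1) μ
  rw [← h, map_measureReal_apply (by fun_prop) measurableSet_Ioi, Phi, cdf_eq_real,
    measureReal_congr (Iio_ae_eq_Iic (a := μ)).symm]
  congr 1
  ext z
  simp

lemma gaussianReal_real_Iic (μ : ℝ) : (gaussianReal μ 1).real (Set.Iic 0) = Phi (-μ) := by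
  rw [← Set.compl_Ioi, probReal_compl_eq_one_sub measurableSet_Ioi, gaussianReal_real_Ioi, Phi_neg]

lemma gaussianPDFReal_even (t : ℝ) : gaussianPDFReal 0 1 (-t) = gaussianPDFReal 0 1 t := by
  simp [gaussianPDFReal]

lemma gaussianPDFReal_apply_zero (μ : ℝ) : gaussianPDFReal μ 1 0 = gaussianPDFReal 0 1 μ := by
  simp [gaussianPDFReal]

lemma hasDerivAt_gaussianPDFReal (μ t : ℝ) :
    HasDerivAt (gaussianPDFReal μ 1) (-(t - μ) * gaussianPDFReal μ 1 t) t := by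
  rw [gaussianPDFReal_def]
  have h : HasDerivAt (fun x : ℝ => -(x - μ) ^ 2 / (2 * ((1 : ℝ≥0) : ℝ))) (-(t - μ)) t := by
    have := ((((hasDerivAt_id t).sub_const μ).pow 2).neg).div_const (2 * ((1 : ℝ≥0) : ℝ))
    convert! this using 1
    simp
    ring
  convert! (h.exp.const_mul (√(2 * Real.pi * ((1 : ℝ≥0) : ℝ)))⁻¹) using 1
  ring

lemma tendsto_gaussianPDFReal_atTop (μ : ℝ) :
    Tendsto (gaussianPDFReal μ 1) atTop (𝓝 0) := by
  rw [gaussianPDFReal_def]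
  rw [show (0 : ℝ) = (√(2 * Real.pi * ((1 : ℝ≥0) : ℝ)))⁻¹ * 0 by simp]
  refine Tendsto.const_mul _ (Real.tendsto_exp_atBot.comp ?_)
  have h : Tendsto (fun x : ℝ => (x - μ) ^ 2) atTop atTop :=
    (tendsto_pow_atTop two_ne_zero).comp (tendsto_atTop_add_const_right _ (-μ) tendsto_id)
  have h2 := (h.const_mul_atTop (r := 1 / 2) (by norm_num))
  refine (tendsto_neg_atTop_atBot.comp h2).congr fun x => ?_
  simp
  ring

lemma integrable_mul_gaussianPDFReal (μ : ℝ) :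
    Integrable (fun z => z * gaussianPDFReal μ 1 z) := by
  have h : Integrable (fun z : ℝ => z) (gaussianReal μ 1) :=
    (memLp_id_gaussianReal (μ := μ) (v := 1) 1).integrable (le_of_eq ENNReal.coe_one.symm)
  rw [gaussianReal_of_var_ne_zero _ one_ne_zero,
    integrable_withDensity_iff_integrable_smul' (measurable_gaussianPDF μ 1)
      (Eventually.of_forall fun _ => gaussianPDF_lt_top)] at h
  refine h.congr (Eventually.of_forall fun z => ?_)
  simp [mul_comm]

lemma integral_Ioi_mul_gaussianPDFReal (μ : ℝ) :
    ∫ z in Set.Ioi 0, z * gaussianPDFReal μ 1 z = μ * Phi μ + gaussianPDFReal 0 1 μ := by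
  have hI := integrable_mul_gaussianPDFReal μ
  have hJ := (integrable_gaussianPDFReal μ 1).const_mul μ
  have h1 : ∫ z in Set.Ioi 0, (z * gaussianPDFReal μ 1 z - μ * gaussianPDFReal μ 1 z) =
      0 - (- gaussianPDFReal μ 1 0) := by
    refine integral_Ioi_of_hasDerivAt_of_tendsto (f := fun z => - gaussianPDFReal μ 1 z)
      (continuous_gaussianPDFReal_one μ).neg.continuousWithinAt (fun z _ => ?_)
      (hI.sub hJ).integrableOn (by simpa using (tendsto_gaussianPDFReal_atTop μ).neg)
    convert! (hasDerivAt_gaussianPDFReal μ z).neg using 1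
    ring
  rw [integral_sub hI.integrableOn hJ.integrableOn, integral_const_mul] at h1
  have h2 : ∫ z in Set.Ioi 0, gaussianPDFReal μ 1 z = Phi μ := by
    rw [← gaussianReal_real_Ioi, measureReal_def, gaussianReal_apply_eq_integral _ one_ne_zero,
      ENNReal.toReal_ofReal]
    exact integral_nonneg fun z => gaussianPDFReal_nonneg _ _ _
  rw [h2, gaussianPDFReal_apply_zero] at h1
  linarith

lemma integral_Iic_mul_gaussianPDFReal (μ : ℝ) :
    ∫ z in Set.Iic 0, z * gaussianPDFReal μ 1 z = μ * Phi (-μ) - gaussianPDFReal 0 1 μ := by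
  have h := intervalIntegral.integral_Iic_add_Ioi (b := 0)
    (integrable_mul_gaussianPDFReal μ).integrableOn (integrable_mul_gaussianPDFReal μ).integrableOn
  have h2 : ∫ z, z * gaussianPDFReal μ 1 z = μ := by
    have := integral_id_gaussianReal (μ := μ) (v := 1)
    rw [integral_gaussianReal_eq_integral_smul one_ne_zero] at this
    simpa [mul_comm] using this
  rw [h2, integral_Ioi_mul_gaussianPDFReal] at h
  rw [Phi_neg]
  linarith

/-- This is the positivity of the mean of a normal distribution truncated to `(0, ∞)`; it makes the
inverse Mills ratio strictly decreasing. -/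
lemma mills_add_self_pos (t : ℝ) : 0 < mills t + t := by
  have h : 0 < ∫ z in Set.Ioi 0, z * gaussianPDFReal t 1 z := by
    rw [setIntegral_pos_iff_support_of_nonneg_ae]
    · have : Function.support (fun z => z * gaussianPDFReal t 1 z) ∩ Set.Ioi 0 = Set.Ioi 0 := by
        refine Set.inter_eq_right.2 fun z hz => ?_
        exact (mul_pos hz (gaussianPDFReal_pos t 1 z one_ne_zero)).ne'
      rw [this]
      simp
    · refine (ae_restrict_mem measurableSet_Ioi).mono fun z hz => ?_
      exact mul_nonneg (le_of_lt hz) (gaussianPDFReal_nonneg _ _ _)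
    · exact (integrable_mul_gaussianPDFReal t).integrableOn
  rw [integral_Ioi_mul_gaussianPDFReal] at h
  have hp := Phi_pos t
  have : mills t + t = (t * Phi t + gaussianPDFReal 0 1 t) / Phi t := by
    rw [mills]
    field_simp
    ring
  rw [this]
  positivity

lemma mills_pos (t : ℝ) : 0 < mills t :=
  div_pos (gaussianPDFReal_pos 0 1 t one_ne_zero) (Phi_pos t)

lemma hasDerivAt_log_Phi (t : ℝ) : HasDerivAt (fun s => Real.log (Phi s)) (mills t) t :=
  (hasDerivAt_Phi t).log (Phi_pos t).ne'

lemma hasDerivAt_mills (t : ℝ) : HasDerivAt mills (-(mills t * (mills t + t))) t := by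
  have hp := (Phi_pos t).ne'
  have h := (hasDerivAt_gaussianPDFReal 0 t).div (hasDerivAt_Phi t) hp
  convert! h using 1
  rw [mills]
  field_simp
  ring

lemma continuous_mills : Continuous mills :=
  continuous_iff_continuousAt.2 fun t => (hasDerivAt_mills t).continuousAt

lemma strictAnti_mills : StrictAnti mills :=
  strictAnti_of_deriv_neg fun t => by
    rw [(hasDerivAt_mills t).deriv]
    exact neg_neg_of_pos (mul_pos (mills_pos t) (mills_add_self_pos t))

lemma concaveOn_log_Phi : ConcaveOn ℝ Set.univ fun t => Real.log (Phi t) := by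
  refine Antitone.concaveOn_univ_of_deriv (fun t => (hasDerivAt_log_Phi t).differentiableAt) ?_
  have : (deriv fun t => Real.log (Phi t)) = mills := funext fun t => (hasDerivAt_log_Phi t).deriv
  rw [this]
  exact strictAnti_mills.antitone

/-- A function whose derivative decreases at rate at least `2 m` on an interval lies, there, below
its tangents by at least the parabola `m (t - s)²`. -/
lemma le_tangent_sub_sq {f f' : ℝ → ℝ} {D : Set ℝ} (hD : Convex ℝ D) {m : ℝ}
    (hf : ∀ t, HasDerivAt f (f' t) t) (hanti : AntitoneOn (fun t => f' t + 2 * m * t) D)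
    {s t : ℝ} (hs : s ∈ D) (ht : t ∈ D) :
    f t ≤ f s + f' s * (t - s) - m * (t - s) ^ 2 := by
  set g : ℝ → ℝ := fun u => f u - f' s * (u - s) + m * (u - s) ^ 2 with hg
  have hd : ∀ u, HasDerivAt g (f' u + 2 * m * u - (f' s + 2 * m * s)) u := fun u => by
    have h1 := ((hasDerivAt_id u).sub_const s)
    have h := ((hf u).sub (h1.const_mul (f' s))).add ((h1.pow 2).const_mul m)
    convert! h using 1
    simp
    ring
  have hgs : g s = f s := by simp [hg]
  suffices h : g t ≤ g s by
    rw [hgs] at h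
    simp only [hg] at h
    linarith
  have hcont : Continuous g := continuous_iff_continuousAt.2 fun u => (hd u).continuousAt
  rcases le_total s t with hst | hst
  · have hsub : Set.Icc s t ⊆ D := hD.ordConnected.out hs ht
    refine antitoneOn_of_deriv_nonpos (convex_Icc s t) hcont.continuousOn
      (fun u _ => (hd u).differentiableAt.differentiableWithinAt) (fun u hu => ?_)
      (Set.left_mem_Icc.2 hst) (Set.right_mem_Icc.2 hst) hst
    rw [interior_Icc] at hu
    rw [(hd u).deriv]
    have := hanti hs (hsub (Set.Ioo_subset_Icc_self hu)) hu.1.le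
    simp only at this
    linarith
  · have hsub : Set.Icc t s ⊆ D := hD.ordConnected.out ht hs
    refine monotoneOn_of_deriv_nonneg (convex_Icc t s) hcont.continuousOn
      (fun u _ => (hd u).differentiableAt.differentiableWithinAt) (fun u hu => ?_)
      (Set.left_mem_Icc.2 hst) (Set.right_mem_Icc.2 hst) hst
    rw [interior_Icc] at hu
    rw [(hd u).deriv]
    have := hanti (hsub (Set.Ioo_subset_Icc_self hu)) hs hu.2.le
    simp only at this
    linarith

lemma log_Phi_le_tangent (s t : ℝ) :
    Real.log (Phi t) ≤ Real.log (Phi s) + mills s * (t - s) := by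
  have h := le_tangent_sub_sq (m := 0) convex_univ hasDerivAt_log_Phi
    (by simpa using strictAnti_mills.antitone) (Set.mem_univ s) (Set.mem_univ t)
  simpa using h

lemma exists_log_Phi_le_tangent_sub_sq (T : ℝ) :
    ∃ m : ℝ, 0 < m ∧ ∀ s t : ℝ, |s| ≤ T → |t| ≤ T →
      Real.log (Phi t) ≤ Real.log (Phi s) + mills s * (t - s) - m * (t - s) ^ 2 := by
  rcases lt_or_ge T 0 with hT | hT
  · exact ⟨1, one_pos, fun s t hs => absurd ((abs_nonneg s).trans hs) (not_le.2 hT)⟩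
  have hc : Continuous fun t => mills t * (mills t + t) := by
    have := continuous_mills
    fun_prop
  obtain ⟨t₀, -, hmin⟩ := (isCompact_Icc (a := -T) (b := T)).exists_isMinOn
    ⟨0, by constructor <;> linarith⟩ hc.continuousOn
  refine ⟨mills t₀ * (mills t₀ + t₀) / 2,
    half_pos (mul_pos (mills_pos _) (mills_add_self_pos _)), fun s t hs ht => ?_⟩
  refine le_tangent_sub_sq (convex_Icc (-T) T) hasDerivAt_log_Phi ?_ (abs_le.1 hs) (abs_le.1 ht)
  have hd : ∀ u, HasDerivAt (fun t => mills t + 2 * (mills t₀ * (mills t₀ + t₀) / 2) * t)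
      (-(mills u * (mills u + u)) + mills t₀ * (mills t₀ + t₀)) u := fun u => by
    convert! (hasDerivAt_mills u).add
      ((hasDerivAt_id u).const_mul (2 * (mills t₀ * (mills t₀ + t₀) / 2))) using 1
    ring
  refine antitoneOn_of_deriv_nonpos (convex_Icc _ _)
    (fun u _ => (hd u).continuousAt.continuousWithinAt)
    (fun u _ => (hd u).differentiableAt.differentiableWithinAt) (fun u hu => ?_)
  rw [(hd u).deriv]
  have := hmin (interior_subset hu)
  simp only [Set.mem_ofPred_eq] at this
  linarith

lemma gaussianPDFReal_le_exp (t : ℝ) : gaussianPDFReal 0 1 t ≤ Real.exp (-t ^ 2 / 2) := by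
  have h : (√(2 * Real.pi))⁻¹ ≤ 1 := by
    refine inv_le_one_of_one_le₀ (Real.one_le_sqrt.2 ?_)
    linarith [Real.pi_gt_three]
  calc gaussianPDFReal 0 1 t = (√(2 * Real.pi))⁻¹ * Real.exp (-t ^ 2 / 2) := by
        simp [gaussianPDFReal]
    _ ≤ 1 * Real.exp (-t ^ 2 / 2) := by gcongr
    _ = Real.exp (-t ^ 2 / 2) := one_mul _

/-- For `t ≤ 0`, bounding the density on `[t - 1, t]` from below gives
`Φ(t) ≥ φ(t - 1) = φ(t) exp(t - 1/2)`. -/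
lemma exists_gaussianPDFReal_mul_mills_le :
    ∃ V : ℝ, 0 < V ∧ ∀ t, gaussianPDFReal 0 1 t * mills t ≤ V := by
  refine ⟨mills 0 + Real.exp 1, add_pos (mills_pos 0) (Real.exp_pos 1), fun t => ?_⟩
  have hpos := gaussianPDFReal_nonneg 0 1 t
  rcases le_total 0 t with ht | ht
  · have h1 := strictAnti_mills.antitone ht
    have h2 : gaussianPDFReal 0 1 t ≤ 1 :=
      (gaussianPDFReal_le_exp t).trans (Real.exp_le_one_iff.2 (by nlinarith [sq_nonneg t]))
    nlinarith [mills_pos t, Real.exp_pos 1]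
  · have h1 : gaussianPDFReal 0 1 (t - 1) ≤ Phi t := by
      have h := Phi_sub_eq_intervalIntegral (t - 1) t
      have h2 : ∫ z in (t - 1)..t, gaussianPDFReal 0 1 (t - 1) ≤
          ∫ z in (t - 1)..t, gaussianPDFReal 0 1 z := by
        refine intervalIntegral.integral_mono_on (by linarith) (by simp)
          ((continuous_gaussianPDFReal_one 0).intervalIntegrable _ _) fun z hz => ?_
        simp only [gaussianPDFReal, NNReal.coe_one, mul_one, sub_zero]
        gcongr ?_ * Real.exp (?_ / 2)
        nlinarith [hz.1, hz.2]
      simp only [intervalIntegral.integral_const, sub_sub_cancel, one_smul] at h2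
      linarith [(Phi_pos (t - 1)).le]
    have h2 : gaussianPDFReal 0 1 t = gaussianPDFReal 0 1 (t - 1) * Real.exp (1 / 2 - t) := by
      simp only [gaussianPDFReal, mul_assoc, ← Real.exp_add]
      congr 2
      simp
      ring
    have h3 : gaussianPDFReal 0 1 t * Real.exp (1 / 2 - t) ≤ Real.exp 1 := by
      calc gaussianPDFReal 0 1 t * Real.exp (1 / 2 - t)
          ≤ Real.exp (-t ^ 2 / 2) * Real.exp (1 / 2 - t) := by
            gcongr
            exact gaussianPDFReal_le_exp t
        _ = Real.exp (-t ^ 2 / 2 + (1 / 2 - t)) := (Real.exp_add _ _).symm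
        _ ≤ Real.exp 1 := by
            gcongr
            nlinarith [sq_nonneg (t + 1)]
    have h4 : gaussianPDFReal 0 1 t * mills t ≤ Real.exp 1 := by
      rw [mills, ← mul_div_assoc, div_le_iff₀ (Phi_pos t)]
      calc gaussianPDFReal 0 1 t * gaussianPDFReal 0 1 t =
          (gaussianPDFReal 0 1 t * Real.exp (1 / 2 - t)) * gaussianPDFReal 0 1 (t - 1) := by
            nth_rewrite 2 [h2]
            ring
        _ ≤ Real.exp 1 * Phi t := mul_le_mul h3 h1 (gaussianPDFReal_nonneg _ _ _) (Real.exp_nonneg _)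
    linarith [mills_pos 0]

/-! ### Truncated normal distributions and the probit likelihood -/

/-- The sign `±1` of a binary outcome. With it the probability of outcome `y` at location `μ` is
`Phi (outcomeSign y * μ)` for both values of `y`. -/
def outcomeSign (y : Bool) : ℝ := if y then 1 else -1

lemma outcomeSign_sq (y : Bool) : outcomeSign y ^ 2 = 1 := by
  cases y <;> simp [outcomeSign]

lemma abs_outcomeSign (y : Bool) : |outcomeSign y| = 1 := by
  cases y <;> simp [outcomeSign]

lemma gaussianReal_real_latentSet (μ : ℝ) (y : Bool) :
    (gaussianReal μ 1).real (latentSet y) = Phi (outcomeSign y * μ) := by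
  cases y
  · simp [latentSet, outcomeSign, gaussianReal_real_Iic]
  · simp [latentSet, outcomeSign, gaussianReal_real_Ioi]

lemma measurableSet_latentSet (y : Bool) : MeasurableSet (latentSet y) := by
  cases y
  · simp [latentSet]
  · simp [latentSet]

/-- The truncation shifts the mean by the derivative in `μ` of the log-probability of `y`. -/
lemma truncMean_eq (μ : ℝ) (y : Bool) :
    truncMean μ y = μ + outcomeSign y * mills (outcomeSign y * μ) := by
  have h1 : truncMean μ y =
      (∫ z in latentSet y, z * gaussianPDFReal μ 1 z) / Phi (outcomeSign y * μ) := by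
    rw [truncMean, ← integral_indicator (measurableSet_latentSet y), ← integral_div]
    congr 1
    ext z
    by_cases hz : z ∈ latentSet y
    · simp [truncDensity, hz, gaussianReal_real_latentSet, mul_div_assoc]
    · simp [truncDensity, hz]
  rw [h1]
  cases y
  · have hp := (Phi_pos (-μ)).ne'
    have h2 := integral_Iic_mul_gaussianPDFReal μ
    simp only [latentSet, outcomeSign, Bool.false_eq_true, if_false, neg_one_mul, h2, mills,
      gaussianPDFReal_even]
    field_simp
    ring
  · have hp := (Phi_pos μ).ne'
    have h2 := integral_Ioi_mul_gaussianPDFReal μ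
    simp only [latentSet, outcomeSign, if_true, one_mul, h2, mills]
    field_simp

lemma truncMean_mem (μ : ℝ) (y : Bool) : truncMean μ y ∈ latentSet y := by
  rw [truncMean_eq]
  cases y
  · have := mills_add_self_pos (-μ)
    simp [latentSet, outcomeSign]
    linarith
  · have := mills_add_self_pos μ
    simp [latentSet, outcomeSign]
    linarith

section Likelihood

variable {n : ℕ} {ι : Type} [Fintype ι]

/-- The probit log-likelihood as a function of the linear predictors. -/
def logLik (y : Fin n → Bool) (η : Fin n → ℝ) : ℝ := ∑ i, Real.log (Phi (outcomeSign (y i) * η i))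

/-- The derivative of the `i`-th term of `logLik` with respect to the `i`-th linear predictor. -/
def score (y : Fin n → Bool) (η : Fin n → ℝ) (i : Fin n) : ℝ :=
  outcomeSign (y i) * mills (outcomeSign (y i) * η i)

lemma probitLik_eq (X : Matrix (Fin n) ι ℝ) (y : Fin n → Bool) (a : ℝ) (b : ι → ℝ) :
    probitLik X y a b = ∏ i, Phi (outcomeSign (y i) * linPred X a b i) := by
  refine Finset.prod_congr rfl fun i _ => ?_
  cases y i <;> simp [outcomeSign, Phi_neg]

lemma log_probitLik (X : Matrix (Fin n) ι ℝ) (y : Fin n → Bool) (a : ℝ) (b : ι → ℝ) :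
    Real.log (probitLik X y a b) = logLik y (linPred X a b) := by
  rw [probitLik_eq, logLik, Real.log_prod fun i _ => (Phi_pos _).ne']

lemma probitLik_pos (X : Matrix (Fin n) ι ℝ) (y : Fin n → Bool) (a : ℝ) (b : ι → ℝ) :
    0 < probitLik X y a b := by
  rw [probitLik_eq]
  exact Finset.prod_pos fun i _ => Phi_pos _

lemma zhat_eq (X : Matrix (Fin n) ι ℝ) (y : Fin n → Bool) (q : VBParams ι) (i : Fin n) :
    zhat X y q i = linPred X q.muA q.muB i + score y (linPred X q.muA q.muB) i :=
  truncMean_eq _ _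

lemma qz_zhat_pos (X : Matrix (Fin n) ι ℝ) (y : Fin n → Bool) (q : VBParams ι) :
    0 < qz X y q (zhat X y q) := by
  refine Finset.prod_pos fun i _ => ?_
  have hm : zhat X y q i ∈ latentSet (y i) := truncMean_mem _ _
  rw [truncDensity, Set.indicator_of_mem hm, gaussianReal_real_latentSet]
  exact div_pos (gaussianPDFReal_pos _ _ _ one_ne_zero) (Phi_pos _)

/-- The truncated density is the normal density divided by the probability of the outcome, so the
ratio leaves exactly these probabilities. -/
lemma obsLik_mul_latentDensity_div_qz (X : Matrix (Fin n) ι ℝ) (y : Fin n → Bool)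
    (q : VBParams ι) :
    obsLik y (zhat X y q) * latentDensity X q.muA q.muB (zhat X y q) / qz X y q (zhat X y q) =
      probitLik X y q.muA q.muB := by
  rw [div_eq_iff (qz_zhat_pos X y q).ne', probitLik_eq, obsLik, latentDensity, qz,
    ← Finset.prod_mul_distrib, ← Finset.prod_mul_distrib]
  refine Finset.prod_congr rfl fun i _ => ?_
  have hm : zhat X y q i ∈ latentSet (y i) := truncMean_mem _ _
  rw [linkLik, truncDensity, Set.indicator_of_mem hm, Set.indicator_of_mem hm,
    gaussianReal_real_latentSet, one_mul]
  exact (mul_div_cancel₀ _ (Phi_pos _).ne').symm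

end Likelihood

/-! ### Concavity of the log-likelihood -/

section Concavity

variable {n : ℕ}

lemma logLik_nonpos (y : Fin n → Bool) (η : Fin n → ℝ) : logLik y η ≤ 0 :=
  Finset.sum_nonpos fun _ _ => Real.log_nonpos (Phi_pos _).le (Phi_le_one _)

lemma logLik_zero (y : Fin n → Bool) : logLik y 0 = -(n * Real.log 2) := by
  have h : Phi 0 = 2⁻¹ := by
    have := Phi_neg 0
    rw [neg_zero] at this
    linarith
  simp [logLik, h, Real.log_inv]

/-- Second order bound: all terms lie below their tangents, and those in `I`, whose predictors stay
in `[-T, T]`, by at least `m` times the squared increment. -/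
lemma logLik_add_le (y : Fin n → Bool) (η d : Fin n → ℝ) (I : Finset (Fin n)) {T m : ℝ}
    (hm : ∀ s t : ℝ, |s| ≤ T → |t| ≤ T →
      Real.log (Phi t) ≤ Real.log (Phi s) + mills s * (t - s) - m * (t - s) ^ 2)
    (hη : ∀ i ∈ I, |η i| ≤ T) (hd : ∀ i ∈ I, |η i + d i| ≤ T) :
    logLik y (η + d) ≤ logLik y η + ∑ i, score y η i * d i - m * ∑ i ∈ I, d i ^ 2 := by
  have h1 : ∑ i ∈ I, d i ^ 2 = ∑ i, if i ∈ I then d i ^ 2 else 0 := by simp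
  rw [h1, Finset.mul_sum, logLik, logLik, ← Finset.sum_add_distrib, ← Finset.sum_sub_distrib]
  refine Finset.sum_le_sum fun i _ => ?_
  have hs := outcomeSign_sq (y i)
  have e1 : outcomeSign (y i) * (η + d) i - outcomeSign (y i) * η i = outcomeSign (y i) * d i := by
    simp only [Pi.add_apply]
    ring
  by_cases hi : i ∈ I
  · have h := hm (outcomeSign (y i) * η i) (outcomeSign (y i) * (η + d) i)
      (by simpa [abs_mul, abs_outcomeSign] using hη i hi)
      (by simpa [abs_mul, abs_outcomeSign] using hd i hi)
    rw [e1, mul_pow, hs] at h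
    simp only [score, hi, if_true]
    linarith
  · have h := log_Phi_le_tangent (outcomeSign (y i) * η i) (outcomeSign (y i) * (η + d) i)
    rw [e1] at h
    simp only [score, hi, if_false]
    linarith

/-- Slopes of the concave log-likelihood decrease along a ray. -/
lemma logLik_add_sub_le (y : Fin n → Bool) (η d : Fin n → ℝ) {τ : ℝ} (h0 : 0 < τ) (h1 : τ ≤ 1) :
    τ * (logLik y (η + d) - logLik y η) ≤ logLik y (η + τ • d) - logLik y η := by
  rw [logLik, logLik, logLik, ← Finset.sum_sub_distrib, ← Finset.sum_sub_distrib, Finset.mul_sum]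
  refine Finset.sum_le_sum fun i _ => ?_
  have h := concaveOn_log_Phi.2 (Set.mem_univ (outcomeSign (y i) * (η + d) i))
    (Set.mem_univ (outcomeSign (y i) * η i)) h0.le (sub_nonneg.2 h1) (by ring)
  have e : τ • (outcomeSign (y i) * (η + d) i) + (1 - τ) • (outcomeSign (y i) * η i) =
      outcomeSign (y i) * (η + τ • d) i := by
    simp only [smul_eq_mul, Pi.add_apply, Pi.smul_apply]
    ring
  rw [e] at h
  simp only [smul_eq_mul] at h
  linarith

lemma score_sub_mul_sub_nonpos (y : Fin n → Bool) (η η' : Fin n → ℝ) (i : Fin n) :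
    (score y η i - score y η' i) * (η i - η' i) ≤ 0 ∧
      ((score y η i - score y η' i) * (η i - η' i) = 0 → η i = η' i) := by
  have hs := outcomeSign_sq (y i)
  have hs0 : outcomeSign (y i) ≠ 0 := by
    intro h
    rw [h] at hs
    norm_num at hs
  set s := outcomeSign (y i) with hsdef
  have e : (score y η i - score y η' i) * (η i - η' i) =
      (mills (s * η i) - mills (s * η' i)) * (s * η i - s * η' i) := by
    simp only [score, ← hsdef]
    ring
  have hlt : s * η i ≠ s * η' i →
      (mills (s * η i) - mills (s * η' i)) * (s * η i - s * η' i) < 0 := fun hne => by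
    rcases lt_or_gt_of_ne hne with h | h
    · exact mul_neg_of_pos_of_neg (sub_pos.2 (strictAnti_mills h)) (sub_neg.2 h)
    · exact mul_neg_of_neg_of_pos (sub_neg.2 (strictAnti_mills h)) (sub_pos.2 h)
  rw [e]
  by_cases hne : s * η i = s * η' i
  · exact ⟨by simp [hne], fun _ => mul_left_cancel₀ hs0 hne⟩
  · exact ⟨(hlt hne).le, fun h => absurd h (hlt hne).ne⟩

lemma hasDerivAt_logLik (y : Fin n → Bool) (η d : Fin n → ℝ) :
    HasDerivAt (fun t : ℝ => logLik y (η + t • d)) (∑ i, score y η i * d i) 0 := by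
  refine HasDerivAt.fun_sum fun i _ => ?_
  have h1 : HasDerivAt (fun t : ℝ => outcomeSign (y i) * (η + t • d) i)
      (outcomeSign (y i) * d i) 0 := by
    have := (((hasDerivAt_id (0 : ℝ)).mul_const (d i)).const_add (η i)).const_mul
      (outcomeSign (y i))
    simpa using this
  have h2 := (hasDerivAt_log_Phi (outcomeSign (y i) * (η + (0 : ℝ) • d) i)).comp (0 : ℝ) h1
  convert! h2 using 1
  simp [score]
  ring

lemma continuous_logLik (y : Fin n → Bool) : Continuous (logLik y) := by
  have h : Continuous fun t => Real.log (Phi t) :=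
    continuous_iff_continuousAt.2 fun t => (hasDerivAt_log_Phi t).continuousAt
  refine continuous_finsetSum _ fun i _ => h.comp ?_
  fun_prop

end Concavity

/-! ### Variational solutions as penalized maximum likelihood estimates -/

section FixedPoint

variable {n : ℕ} {ι : Type} [Fintype ι]

/-- The log-likelihood with the Gaussian penalty coming from the `g`-prior on the slopes. -/
def penLogLik (g : ℝ) (X : Matrix (Fin n) ι ℝ) (y : Fin n → Bool) (a : ℝ) (b : ι → ℝ) : ℝ :=
  logLik y (linPred X a b) - (X *ᵥ b) ⬝ᵥ (X *ᵥ b) / (2 * g)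

/-- The first order conditions for a maximum of `penLogLik`. -/
structure IsStationary (g : ℝ) (X : Matrix (Fin n) ι ℝ) (y : Fin n → Bool) (a : ℝ) (b : ι → ℝ) :
    Prop where
  intercept : ∑ i, score y (linPred X a b) i = 0
  slope : Xᵀ *ᵥ (X *ᵥ b) = g • (Xᵀ *ᵥ score y (linPred X a b))

lemma sum_mulVec_eq_zero {X : Matrix (Fin n) ι ℝ} (hX : ∀ j, ∑ i, X i j = 0) (b : ι → ℝ) :
    ∑ i, (X *ᵥ b) i = 0 := by
  simp only [Matrix.mulVec, dotProduct]
  rw [Finset.sum_comm]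
  simp [← Finset.sum_mul, hX]

lemma linPred_add_smul (X : Matrix (Fin n) ι ℝ) (a a' t : ℝ) (b b' : ι → ℝ) :
    linPred X (a + t * a') (b + t • b') = linPred X a b + t • linPred X a' b' := by
  ext i
  simp only [linPred, Matrix.mulVec_add, Matrix.mulVec_smul, Pi.add_apply, Pi.smul_apply,
    smul_eq_mul]
  ring

lemma sum_mul_linPred (X : Matrix (Fin n) ι ℝ) (w : Fin n → ℝ) (a : ℝ) (b : ι → ℝ) :
    ∑ i, w i * linPred X a b i = a * ∑ i, w i + (Xᵀ *ᵥ w) ⬝ᵥ b := by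
  have h : (Xᵀ *ᵥ w) ⬝ᵥ b = w ⬝ᵥ (X *ᵥ b) := by
    rw [Matrix.mulVec_transpose, Matrix.dotProduct_mulVec]
  rw [h, dotProduct, Finset.mul_sum, ← Finset.sum_add_distrib]
  refine Finset.sum_congr rfl fun i _ => ?_
  simp only [linPred]
  ring

variable [DecidableEq ι]

/-- A maximizer satisfies the first order conditions in the direction of the intercept and of each
slope. -/
lemma isStationary_of_isMax {g : ℝ} (hg : 0 < g) {X : Matrix (Fin n) ι ℝ} {y : Fin n → Bool}
    {a : ℝ} {b : ι → ℝ} (hmax : ∀ a' b', penLogLik g X y a' b' ≤ penLogLik g X y a b) :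
    IsStationary g X y a b := by
  have key : ∀ a' b', ∑ i, score y (linPred X a b) i * linPred X a' b' i =
      (X *ᵥ b) ⬝ᵥ (X *ᵥ b') / g := fun a' b' => by
    have hq : HasDerivAt (fun t : ℝ => (X *ᵥ (b + t • b')) ⬝ᵥ (X *ᵥ (b + t • b')) / (2 * g))
        ((X *ᵥ b) ⬝ᵥ (X *ᵥ b') / g) 0 := by
      have e : (fun t : ℝ => (X *ᵥ (b + t • b')) ⬝ᵥ (X *ᵥ (b + t • b')) / (2 * g)) =
          fun t => ((X *ᵥ b) ⬝ᵥ (X *ᵥ b) + t * (2 * ((X *ᵥ b) ⬝ᵥ (X *ᵥ b'))) +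
            t ^ 2 * ((X *ᵥ b') ⬝ᵥ (X *ᵥ b'))) / (2 * g) := by
        ext t
        simp only [Matrix.mulVec_add, Matrix.mulVec_smul, dotProduct_add, add_dotProduct,
          smul_dotProduct, dotProduct_smul, smul_eq_mul, dotProduct_comm (X *ᵥ b') (X *ᵥ b)]
        ring
      rw [e]
      have := ((((hasDerivAt_id (0 : ℝ)).mul_const (2 * ((X *ᵥ b) ⬝ᵥ (X *ᵥ b')))).const_add
        ((X *ᵥ b) ⬝ᵥ (X *ᵥ b))).add
        (((hasDerivAt_id (0 : ℝ)).pow 2).mul_const ((X *ᵥ b') ⬝ᵥ (X *ᵥ b')))).div_const (2 * g)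
      convert! this using 1
      simp
      field_simp
    have hd := (hasDerivAt_logLik y (linPred X a b) (linPred X a' b')).sub hq
    have hloc : IsLocalMax (fun t : ℝ => logLik y (linPred X a b + t • linPred X a' b') -
        (X *ᵥ (b + t • b')) ⬝ᵥ (X *ᵥ (b + t • b')) / (2 * g)) 0 := by
      refine Eventually.of_forall fun t => ?_
      have h := hmax (a + t * a') (b + t • b')
      rw [penLogLik, linPred_add_smul] at h
      simpa [penLogLik] using h
    have := hloc.hasDerivAt_eq_zero hd
    linarith
  refine ⟨?_, ?_⟩
  · have := key 1 0
    simpa [linPred] using this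
  · ext j
    have := key 0 (Pi.single j 1)
    rw [sum_mul_linPred] at this
    have e : (X *ᵥ b) ⬝ᵥ (X *ᵥ Pi.single j 1) = (Xᵀ *ᵥ (X *ᵥ b)) j := by
      rw [Matrix.dotProduct_mulVec, ← Matrix.mulVec_transpose, dotProduct_single_one]
    rw [e, zero_mul, zero_add, dotProduct_single_one, eq_div_iff hg.ne'] at this
    simp only [Pi.smul_apply, smul_eq_mul]
    linarith

/-- Strict concavity: the scores at two stationary points have a nonpositive pairing with the
difference of the predictors, and the penalty makes this pairing nonnegative. -/
lemma IsStationary.unique {g : ℝ} (hg : 0 < g) (hn : 0 < n) {X : Matrix (Fin n) ι ℝ}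
    (hX : ∀ j, ∑ i, X i j = 0) (hdet : IsUnit (Xᵀ * X).det) {y : Fin n → Bool} {a a' : ℝ}
    {b b' : ι → ℝ} (h : IsStationary g X y a b) (h' : IsStationary g X y a' b') :
    a = a' ∧ b = b' := by
  set η := linPred X a b with hη
  set η' := linPred X a' b' with hη'
  have hsub : ∀ i, η i - η' i = linPred X (a - a') (b - b') i := fun i => by
    simp only [hη, hη', linPred, Matrix.mulVec_sub, Pi.sub_apply]
    ring
  have hnonneg : 0 ≤ ∑ i, (score y η i - score y η' i) * (η i - η' i) := by
    simp only [hsub]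
    rw [sum_mul_linPred, Finset.sum_sub_distrib, h.intercept, h'.intercept]
    have e : Xᵀ *ᵥ (X *ᵥ (b - b')) = g • (Xᵀ *ᵥ fun i => score y η i - score y η' i) := by
      have : (fun i => score y η i - score y η' i) = score y η - score y η' := rfl
      rw [this, Matrix.mulVec_sub, Matrix.mulVec_sub, Matrix.mulVec_sub, h.slope, h'.slope,
        smul_sub]
    have e2 : 0 ≤ (Xᵀ *ᵥ (X *ᵥ (b - b'))) ⬝ᵥ (b - b') := by
      rw [Matrix.mulVec_transpose, ← Matrix.dotProduct_mulVec]
      exact Finset.sum_nonneg fun i _ => mul_self_nonneg _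
    rw [e, smul_dotProduct, smul_eq_mul] at e2
    have := nonneg_of_mul_nonneg_right e2 hg
    simpa using this
  have hzero : ∀ i, η i = η' i := fun i => by
    have hle : ∀ i ∈ Finset.univ, (score y η i - score y η' i) * (η i - η' i) ≤ 0 :=
      fun i _ => (score_sub_mul_sub_nonpos y η η' i).1
    have := (Finset.sum_eq_zero_iff_of_nonpos hle).1 (le_antisymm (Finset.sum_nonpos hle) hnonneg)
    exact (score_sub_mul_sub_nonpos y η η' i).2 (this i (Finset.mem_univ i))
  have ha : a = a' := by
    have e : ∀ a b, ∑ i, linPred X a b i = n * a := fun a b => by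
      simp [linPred, Finset.sum_add_distrib, sum_mulVec_eq_zero hX]
    have : (n : ℝ) * a = n * a' := by
      rw [← e a b, ← e a' b']
      exact Finset.sum_congr rfl fun i _ => hzero i
    exact mul_left_cancel₀ (by positivity) this
  refine ⟨ha, ?_⟩
  have hXb : X *ᵥ b = X *ᵥ b' := by
    ext i
    have := hzero i
    simp only [hη, hη', linPred, ha] at this
    linarith
  have hinj : (Xᵀ * X) *ᵥ b = (Xᵀ * X) *ᵥ b' := by
    rw [← Matrix.mulVec_mulVec, hXb, Matrix.mulVec_mulVec]
  exact Matrix.mulVec_injective_iff_isUnit.2 ((Matrix.isUnit_iff_isUnit_det _).2 hdet) hinj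

/-- The coordinate-ascent updates of the means are the first order conditions: an update adds to
the current predictor the score, and projects. -/
lemma isVBSolution_iff {g : ℝ} (hg : 0 < g) (hn : 0 < n) {X : Matrix (Fin n) ι ℝ}
    (hX : ∀ j, ∑ i, X i j = 0) (hdet : IsUnit (Xᵀ * X).det) (y : Fin n → Bool)
    (q : VBParams ι) :
    IsVBSolution g X y q ↔ IsStationary g X y q.muA q.muB ∧
      q.omA = (n : ℝ≥0)⁻¹ ∧ q.OmB = (g / (1 + g)) • (Xᵀ * X)⁻¹ := by
  have hn' : (n : ℝ) ≠ 0 := by positivity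
  have hz : zhat X y q = linPred X q.muA q.muB + score y (linPred X q.muA q.muB) :=
    funext (zhat_eq X y q)
  have hA : q.muA = (∑ i, zhat X y q i) / n ↔ ∑ i, score y (linPred X q.muA q.muB) i = 0 := by
    rw [hz, eq_div_iff hn']
    simp only [Pi.add_apply, Finset.sum_add_distrib]
    have : ∑ i, linPred X q.muA q.muB i = q.muA * n := by
      simp [linPred, Finset.sum_add_distrib, sum_mulVec_eq_zero hX, mul_comm]
    rw [this]
    exact left_eq_add
  have hXT : Xᵀ *ᵥ linPred X q.muA q.muB = Xᵀ *ᵥ (X *ᵥ q.muB) := by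
    ext j
    simp only [Matrix.mulVec, dotProduct, Matrix.transpose_apply, linPred, mul_add,
      Finset.sum_add_distrib, ← Finset.sum_mul, hX, zero_mul, zero_add]
  have hB : q.muB = (g / (1 + g)) • ((Xᵀ * X)⁻¹ *ᵥ (Xᵀ *ᵥ zhat X y q)) ↔
      Xᵀ *ᵥ (X *ᵥ q.muB) = g • (Xᵀ *ᵥ score y (linPred X q.muA q.muB)) := by
    have hinj : Function.Injective (Xᵀ * X).mulVec :=
      Matrix.mulVec_injective_iff_isUnit.2 ((Matrix.isUnit_iff_isUnit_det _).2 hdet)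
    rw [← hinj.eq_iff, Matrix.mulVec_smul, Matrix.mulVec_mulVec, Matrix.mul_nonsing_inv _ hdet,
      Matrix.one_mulVec, hz, Matrix.mulVec_add, hXT, ← Matrix.mulVec_mulVec]
    generalize Xᵀ *ᵥ (X *ᵥ q.muB) = u
    generalize Xᵀ *ᵥ score y (linPred X q.muA q.muB) = w
    simp only [funext_iff, Pi.smul_apply, Pi.add_apply, smul_eq_mul]
    refine forall_congr' fun j => ?_
    have h1g : (1 + g) ≠ 0 := by positivity
    rw [div_mul_eq_mul_div, eq_div_iff h1g]
    constructor <;> intro h <;> linarith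
  constructor
  · intro h
    exact ⟨⟨hA.1 h.muA_eq, hB.1 h.muB_eq⟩, h.omA_eq, h.OmB_eq⟩
  · rintro ⟨h, h1, h2⟩
    exact ⟨hdet, hA.2 h.intercept, h1, hB.2 h.slope, h2⟩

end FixedPoint

/-! ### The criterion in closed form -/

section Criterion

variable {n : ℕ} {ι : Type} [Fintype ι] [DecidableEq ι]

lemma multiGaussianDensity_pos (m : ι → ℝ) {S : Matrix ι ι ℝ} (hS : 0 < S.det) (b : ι → ℝ) :
    0 < multiGaussianDensity m S b := by
  rw [multiGaussianDensity]
  have := Real.pi_pos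
  positivity

lemma det_smul_inv_pos {G : Matrix ι ι ℝ} (hG : 0 < G.det) {s : ℝ} (hs : 0 < s) :
    0 < (s • G⁻¹).det := by
  rw [Matrix.det_smul, Matrix.det_nonsing_inv, Ring.inverse_eq_inv']
  positivity

lemma log_multiGaussianDensity (m : ι → ℝ) {G : Matrix ι ι ℝ} (hG : 0 < G.det) {s : ℝ}
    (hs : 0 < s) (b : ι → ℝ) :
    Real.log (multiGaussianDensity m (s • G⁻¹) b) =
      -(1 / 2) * (Fintype.card ι * Real.log (2 * Real.pi) + Fintype.card ι * Real.log s -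
        Real.log G.det) - (b - m) ⬝ᵥ (G *ᵥ (b - m)) / (2 * s) := by
  have hinv : (s • G⁻¹)⁻¹ = s⁻¹ • G := by
    have hu : IsUnit G.det := hG.ne'.isUnit
    refine Matrix.inv_eq_left_inv ?_
    rw [Matrix.smul_mul, Matrix.mul_smul, Matrix.mul_nonsing_inv _ hu, smul_smul,
      inv_mul_cancel₀ hs.ne', one_smul]
  have hdet := det_smul_inv_pos hG hs
  have h2pi : (2 * Real.pi) ^ Fintype.card ι ≠ 0 := by
    have := Real.pi_pos
    positivity
  rw [multiGaussianDensity, Real.log_mul (inv_ne_zero (Real.sqrt_pos.2 (by positivity)).ne')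
    (Real.exp_pos _).ne', Real.log_exp, Real.log_inv, Real.log_sqrt (by positivity),
    Real.log_mul h2pi hdet.ne', hinv, Matrix.det_smul, Matrix.det_nonsing_inv,
    Ring.inverse_eq_inv', Real.log_mul (by positivity) (by positivity), Real.log_pow, Real.log_pow,
    Real.log_inv, Matrix.smul_mulVec, dotProduct_smul, smul_eq_mul]
  field_simp
  ring

lemma det_transpose_mul_self_pos {X : Matrix (Fin n) ι ℝ} (hdet : IsUnit (Xᵀ * X).det) :
    0 < (Xᵀ * X).det := by
  have h : (Xᵀ * X).PosSemidef := by
    simpa using Matrix.posSemidef_conjTranspose_mul_self X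
  exact lt_of_le_of_ne h.det_nonneg hdet.ne_zero.symm

/-- The Gram determinants of the prior and of `q` cancel; what is left of their normalizing
constants is a power of `g / (g / (1 + g)) = 1 + n`. -/
lemma log_pVBC {c : ℝ} (hc : 0 < c) (hn : 0 < n) {X : Matrix (Fin n) ι ℝ} {y : Fin n → Bool}
    {q : VBParams ι} (hq : IsVBSolution (n : ℝ) X y q) :
    Real.log (pVBC c n X y q) = penLogLik n X y q.muA q.muB + Real.log c +
      Real.log (2 * Real.pi) / 2 - Real.log n / 2 - Fintype.card ι / 2 * Real.log (1 + n) := by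
  have hn0 : (0 : ℝ) < n := by positivity
  have hG := det_transpose_mul_self_pos hq.fullRank
  have hpi := Real.pi_pos
  have hs : (0 : ℝ) < n / (1 + n) := by positivity
  have hprior : 0 < multiGaussianDensity 0 ((n : ℝ) • (Xᵀ * X)⁻¹) q.muB :=
    multiGaussianDensity_pos _ (det_smul_inv_pos hG hn0) _
  have hqB : 0 < multiGaussianDensity q.muB q.OmB q.muB := by
    rw [hq.OmB_eq]
    exact multiGaussianDensity_pos _ (det_smul_inv_pos hG hs) _
  have hqA : gaussianPDFReal q.muA q.omA q.muA = √(n / (2 * Real.pi)) := by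
    rw [hq.omA_eq, gaussianPDFReal, ← Real.sqrt_inv]
    simp
    field_simp
  have hqA0 : 0 < √(n / (2 * Real.pi)) := Real.sqrt_pos.2 (by positivity)
  have e : pVBC c n X y q = probitLik X y q.muA q.muB *
      (priorDensity c n X q.muB / qtheta q q.muA q.muB) := by
    rw [← obsLik_mul_latentDensity_div_qz, pVBC, div_mul_div_comm]
  have hquad : (q.muB - 0) ⬝ᵥ ((Xᵀ * X) *ᵥ (q.muB - 0)) = (X *ᵥ q.muB) ⬝ᵥ (X *ᵥ q.muB) := by
    rw [sub_zero, ← Matrix.mulVec_mulVec, Matrix.dotProduct_mulVec, ← Matrix.mulVec_transpose,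
      Matrix.transpose_transpose]
  rw [e, priorDensity, qtheta, hqA, Real.log_mul (probitLik_pos _ _ _ _).ne' (by positivity),
    Real.log_div (by positivity) (by positivity), Real.log_mul hc.ne' hprior.ne',
    Real.log_mul hqA0.ne' hqB.ne', Real.log_sqrt (by positivity), hq.OmB_eq,
    log_multiGaussianDensity _ hG hn0, log_multiGaussianDensity _ hG hs, hquad, sub_self,
    Matrix.mulVec_zero, dotProduct_zero, log_probitLik, penLogLik, Real.log_div hn0.ne'
    (by positivity), Real.log_div hn0.ne' (by positivity)]
  ring

end Criterion

/-! ### A bound on the log-likelihood ratio from the score and the curvature -/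

section LikelihoodRatio

variable {n : ℕ} {ι : Type} [Fintype ι]

lemma linPred_sq_le (X : Matrix (Fin n) ι ℝ) (a : ℝ) (b : ι → ℝ) (i : Fin n) :
    linPred X a b i ^ 2 ≤ (1 + ∑ j, X i j ^ 2) * (a ^ 2 + ∑ j, b j ^ 2) := by
  have h := Finset.sum_mul_sq_le_sq_mul_sq Finset.univ (X i) b
  have hX : 0 ≤ ∑ j, X i j ^ 2 := Finset.sum_nonneg fun _ _ => sq_nonneg _
  have hb : 0 ≤ ∑ j, b j ^ 2 := Finset.sum_nonneg fun _ _ => sq_nonneg _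
  have e : linPred X a b i = a + ∑ j, X i j * b j := rfl
  rw [e]
  set s := ∑ j, X i j * b j
  set U := ∑ j, X i j ^ 2
  set V := ∑ j, b j ^ 2
  -- the mixed term: `2 a s ≤ a² U + V` since `(a s)² ≤ (a² U) V`
  have h2 : 2 * (a * s) ≤ a ^ 2 * U + V := by
    refine le_of_sq_le_sq ?_ (by positivity)
    nlinarith [sq_nonneg (a ^ 2 * U - V), mul_le_mul_of_nonneg_left h (sq_nonneg a)]
  nlinarith

/-- The total score in the intercept and the slopes pairs with a parameter increment by the
Cauchy–Schwarz inequality. -/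
lemma sum_score_mul_linPred_le (X : Matrix (Fin n) ι ℝ) (w : Fin n → ℝ) {S N : ℝ} (hS0 : 0 ≤ S)
    (hN0 : 0 ≤ N) (hS : (∑ i, w i) ^ 2 + ∑ j, (∑ i, w i * X i j) ^ 2 ≤ S ^ 2)
    {a : ℝ} {b : ι → ℝ} (hN : a ^ 2 + ∑ j, b j ^ 2 = N ^ 2) :
    ∑ i, w i * linPred X a b i ≤ S * N := by
  have e : ∀ j, (Xᵀ *ᵥ w) j = ∑ i, w i * X i j := fun j => by
    simp [Matrix.mulVec, dotProduct, mul_comm]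
  rw [sum_mul_linPred]
  simp only [dotProduct, e]
  set s := ∑ i, w i
  set u := fun j => ∑ i, w i * X i j
  have h1 := Finset.sum_mul_sq_le_sq_mul_sq Finset.univ u b
  set t := ∑ j, u j * b j
  set U := ∑ j, u j ^ 2
  set V := ∑ j, b j ^ 2
  have hU : 0 ≤ U := Finset.sum_nonneg fun _ _ => sq_nonneg _
  have hV : 0 ≤ V := Finset.sum_nonneg fun _ _ => sq_nonneg _
  have h2 : 2 * (a * s * t) ≤ a ^ 2 * U + s ^ 2 * V := by
    refine le_of_sq_le_sq ?_ (by positivity)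
    nlinarith [sq_nonneg (a ^ 2 * U - s ^ 2 * V), mul_le_mul_of_nonneg_left h1 (sq_nonneg (a * s))]
  refine le_of_sq_le_sq ?_ (by positivity)
  calc (a * s + t) ^ 2 ≤ (s ^ 2 + U) * (a ^ 2 + V) := by nlinarith
    _ ≤ S ^ 2 * N ^ 2 := by
        rw [hN]
        gcongr
    _ = (S * N) ^ 2 := by ring

/-- If the score is at most `S` and the rows in `I` have curvature at least `K`, the log-likelihood
ratio at distance `N ≤ 1` is below the parabola `S N - m K N²`. -/
lemma logLik_add_linPred_le (y : Fin n → Bool) (η : Fin n → ℝ) (X : Matrix (Fin n) ι ℝ)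
    (I : Finset (Fin n)) {T W m K S : ℝ} (hW0 : 0 ≤ W) (hm0 : 0 ≤ m)
    (hm : ∀ s t : ℝ, |s| ≤ T + W → |t| ≤ T + W →
      Real.log (Phi t) ≤ Real.log (Phi s) + mills s * (t - s) - m * (t - s) ^ 2)
    (hη : ∀ i ∈ I, |η i| ≤ T) (hW : ∀ i ∈ I, 1 + ∑ j, X i j ^ 2 ≤ W ^ 2)
    (hK : ∀ a b, K * (a ^ 2 + ∑ j, b j ^ 2) ≤ ∑ i ∈ I, linPred X a b i ^ 2) (hS0 : 0 ≤ S)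
    (hS : (∑ i, score y η i) ^ 2 + ∑ j, (∑ i, score y η i * X i j) ^ 2 ≤ S ^ 2)
    {a : ℝ} {b : ι → ℝ} {N : ℝ} (hN0 : 0 ≤ N) (hN : a ^ 2 + ∑ j, b j ^ 2 = N ^ 2) (hN1 : N ≤ 1) :
    logLik y (η + linPred X a b) ≤ logLik y η + S * N - m * K * N ^ 2 := by
  have hd : ∀ i ∈ I, |η i + linPred X a b i| ≤ T + W := fun i hi => by
    have h1 : |linPred X a b i| ≤ W := by
      refine abs_le_of_sq_le_sq ((linPred_sq_le X a b i).trans ?_) hW0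
      rw [hN]
      have h2 : N ^ 2 ≤ 1 := pow_le_one₀ hN0 hN1
      have h3 := hW i hi
      have h4 : 0 ≤ 1 + ∑ j, X i j ^ 2 := by positivity
      calc _ ≤ (1 + ∑ j, X i j ^ 2) * 1 := by gcongr
        _ ≤ W ^ 2 := by linarith
    exact (abs_add_le _ _).trans (add_le_add (hη i hi) h1)
  have h1 := logLik_add_le y η (linPred X a b) I hm (fun i hi => (hη i hi).trans (by linarith)) hd
  have h2 := sum_score_mul_linPred_le X (score y η) hS0 hN0 hS hN
  have h3 := mul_le_mul_of_nonneg_left (hK a b) hm0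
  rw [hN] at h3
  linarith

/-- Concavity carries the bound on the sphere of radius `u` to all larger distances. -/
lemma logLik_add_linPred_le_of_le (y : Fin n → Bool) (η : Fin n → ℝ) (X : Matrix (Fin n) ι ℝ)
    {κ S : ℝ}
    (hloc : ∀ (a : ℝ) (b : ι → ℝ) (N : ℝ), 0 ≤ N → a ^ 2 + ∑ j, b j ^ 2 = N ^ 2 → N ≤ 1 →
      logLik y (η + linPred X a b) ≤ logLik y η + S * N - κ * N ^ 2)
    {a : ℝ} {b : ι → ℝ} {N u : ℝ} (hN : a ^ 2 + ∑ j, b j ^ 2 = N ^ 2)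
    (hu0 : 0 < u) (hu1 : u ≤ 1) (huN : u ≤ N) :
    logLik y (η + linPred X a b) ≤ logLik y η + N * (S - κ * u) := by
  have hN0 : 0 < N := hu0.trans_le huN
  have h1 := hloc (u / N * a) ((u / N) • b) u hu0.le (by
    simp only [Pi.smul_apply, smul_eq_mul, mul_pow, ← Finset.mul_sum]
    rw [← mul_add, hN]
    field_simp) hu1
  have e : linPred X (u / N * a) ((u / N) • b) = (u / N) • linPred X a b := by
    have := linPred_add_smul X 0 a (u / N) 0 b
    have h0 : linPred X 0 0 = 0 := by
      ext i
      simp [linPred]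
    simpa [h0] using this
  rw [e] at h1
  have h2 := logLik_add_sub_le y η (linPred X a b) (div_pos hu0 hN0) ((div_le_one hN0).2 huN)
  have h3 : u / N * (logLik y (η + linPred X a b) - logLik y η) ≤ S * u - κ * u ^ 2 := by linarith
  have h4 : logLik y (η + linPred X a b) - logLik y η ≤ (S * u - κ * u ^ 2) / (u / N) := by
    rw [le_div_iff₀ (div_pos hu0 hN0)]
    linarith
  have h5 : (S * u - κ * u ^ 2) / (u / N) = N * (S - κ * u) := by
    field_simp
  linarith

end LikelihoodRatio

/-! ### Centered designs under uniform integrability -/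

section Design

variable {p : ℕ}

/-- The `j`-th covariate of observation `i`, centered by its mean over the first `n` observations;
the entry of every `design` that includes covariate `j`. -/
def centered (x : ℕ → Fin p → ℝ) (n : ℕ) (i : Fin n) (j : Fin p) : ℝ :=
  x i j - (∑ l : Fin n, x l j) / n

lemma design_apply (x : ℕ → Fin p → ℝ) (n : ℕ) (k : Finset (Fin p)) (i : Fin n) (j : k) :
    design x n k i j = centered x n i j := rfl

lemma sum_design (x : ℕ → Fin p → ℝ) {n : ℕ} (k : Finset (Fin p)) (j : k) :
    ∑ i, design x n k i j = 0 := by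
  simp only [design_apply, centered, Finset.sum_sub_distrib, Finset.sum_const, Finset.card_univ,
    Fintype.card_fin, nsmul_eq_mul]
  rcases Nat.eq_zero_or_pos n with rfl | hn
  · simp
  · field_simp
    simp

/-- The slopes of a model as a vector of slopes of all covariates. -/
def extendZero (k : Finset (Fin p)) (b : k → ℝ) (j : Fin p) : ℝ := if h : j ∈ k then b ⟨j, h⟩ else 0

lemma sum_mul_eq_sum_subtype (k : Finset (Fin p)) (g f : Fin p → ℝ) (hf : ∀ j ∉ k, f j = 0) :
    ∑ j : k, g j * f j = ∑ j, g j * f j := by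
  rw [Finset.sum_coe_sort k fun j => g j * f j]
  exact Finset.sum_subset (Finset.subset_univ k) fun j _ hj => by simp [hf j hj]

lemma extendZero_apply (k : Finset (Fin p)) (b : k → ℝ) (j : k) : extendZero k b j = b j := by
  simp [extendZero]

lemma extendZero_of_notMem {k : Finset (Fin p)} (b : k → ℝ) {j : Fin p} (hj : j ∉ k) :
    extendZero k b j = 0 := by
  simp [extendZero, hj]

lemma linPred_design (x : ℕ → Fin p → ℝ) (n : ℕ) (k : Finset (Fin p)) (a : ℝ) (b : k → ℝ)
    (i : Fin n) :
    linPred (design x n k) a b i = a + ∑ j, centered x n i j * extendZero k b j := by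
  rw [← sum_mul_eq_sum_subtype k _ _ fun j => extendZero_of_notMem b]
  simp only [extendZero_apply]
  rfl

/-- The linear predictors of the data-generating model. -/
def trueLinPred (x : ℕ → Fin p → ℝ) (a₀ : ℝ) (b₀ : Fin p → ℝ) (n : ℕ) (i : Fin n) : ℝ :=
  a₀ + ∑ j, x i j * b₀ j

/-- The intercept of the data-generating model in the parametrization by centered covariates. -/
def centeredIntercept (x : ℕ → Fin p → ℝ) (a₀ : ℝ) (b₀ : Fin p → ℝ) (n : ℕ) : ℝ :=
  a₀ + ∑ j, (∑ l : Fin n, x l j) / n * b₀ j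

lemma trueLinPred_eq (x : ℕ → Fin p → ℝ) (a₀ : ℝ) (b₀ : Fin p → ℝ) (n : ℕ) (i : Fin n) :
    trueLinPred x a₀ b₀ n i = centeredIntercept x a₀ b₀ n + ∑ j, centered x n i j * b₀ j := by
  simp only [trueLinPred, centeredIntercept, centered, sub_mul, Finset.sum_sub_distrib]
  ring

/-- The increment from the true parameters to those of a model, seen in a common supermodel. -/
lemma linPred_design_eq_add (x : ℕ → Fin p → ℝ) (a₀ : ℝ) {b₀ : Fin p → ℝ} (n : ℕ)
    {k K : Finset (Fin p)} (hkK : k ⊆ K) (hb₀ : ∀ j ∉ K, b₀ j = 0) (a : ℝ) (b : k → ℝ) :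
    linPred (design x n k) a b = trueLinPred x a₀ b₀ n +
      linPred (design x n K) (a - centeredIntercept x a₀ b₀ n)
        (fun j : K => extendZero k b j - b₀ j) := by
  ext i
  have e : ∑ j, centered x n i j * extendZero K (fun j : K => extendZero k b j - b₀ j) j =
      ∑ j, centered x n i j * (extendZero k b j - b₀ j) := by
    refine Finset.sum_congr rfl fun j _ => ?_
    by_cases hj : j ∈ K
    · rw [extendZero_apply K (fun j : K => extendZero k b j - b₀ j) ⟨j, hj⟩]
    · rw [extendZero_of_notMem _ hj, hb₀ j hj, extendZero_of_notMem _ fun h => hj (hkK h), sub_zero]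
  rw [Pi.add_apply, linPred_design, linPred_design, trueLinPred_eq, e]
  simp only [mul_sub, Finset.sum_sub_distrib]
  ring

/-- The distance between the parameters of a model and the true parameters, the intercept being that
of the centered covariates and the slopes being extended by zero. -/
def paramDist (x : ℕ → Fin p → ℝ) (a₀ : ℝ) (b₀ : Fin p → ℝ) (n : ℕ) (k : Finset (Fin p)) (a : ℝ)
    (b : k → ℝ) : ℝ :=
  √((a - centeredIntercept x a₀ b₀ n) ^ 2 + ∑ j, (extendZero k b j - b₀ j) ^ 2)

lemma paramDist_nonneg (x : ℕ → Fin p → ℝ) (a₀ : ℝ) (b₀ : Fin p → ℝ) (n : ℕ)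
    (k : Finset (Fin p)) (a : ℝ) (b : k → ℝ) : 0 ≤ paramDist x a₀ b₀ n k a b := Real.sqrt_nonneg _

lemma abs_intercept_sub_le_paramDist (x : ℕ → Fin p → ℝ) (a₀ : ℝ) (b₀ : Fin p → ℝ) (n : ℕ)
    (k : Finset (Fin p)) (a : ℝ) (b : k → ℝ) :
    |a - centeredIntercept x a₀ b₀ n| ≤ paramDist x a₀ b₀ n k a b := by
  refine Real.abs_le_sqrt ?_
  have : 0 ≤ ∑ j, (extendZero k b j - b₀ j) ^ 2 := Finset.sum_nonneg fun _ _ => sq_nonneg _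
  linarith

lemma abs_slope_sub_le_paramDist (x : ℕ → Fin p → ℝ) (a₀ : ℝ) (b₀ : Fin p → ℝ) (n : ℕ)
    (k : Finset (Fin p)) (a : ℝ) (b : k → ℝ) (j : Fin p) :
    |extendZero k b j - b₀ j| ≤ paramDist x a₀ b₀ n k a b := by
  refine Real.abs_le_sqrt ?_
  have := Finset.single_le_sum (f := fun j => (extendZero k b j - b₀ j) ^ 2)
    (fun _ _ => sq_nonneg _) (Finset.mem_univ j)
  linarith [sq_nonneg (a - centeredIntercept x a₀ b₀ n)]

lemma sq_add_sum_sq_eq_paramDist_sq (x : ℕ → Fin p → ℝ) (a₀ : ℝ) {b₀ : Fin p → ℝ} (n : ℕ)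
    {k K : Finset (Fin p)} (hkK : k ⊆ K) (hb₀ : ∀ j ∉ K, b₀ j = 0) (a : ℝ) (b : k → ℝ) :
    (a - centeredIntercept x a₀ b₀ n) ^ 2 + ∑ j : K, (extendZero k b j - b₀ j) ^ 2 =
      paramDist x a₀ b₀ n k a b ^ 2 := by
  have h0 : ∀ j ∉ K, extendZero k b j - b₀ j = 0 := fun j hj => by
    rw [hb₀ j hj, extendZero_of_notMem _ fun h => hj (hkK h), sub_zero]
  rw [paramDist, Real.sq_sqrt (by positivity)]
  congr 1
  simpa only [← sq] using sum_mul_eq_sum_subtype K (fun j => extendZero k b j - b₀ j) _ h0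

/-- Uniform integrability of the squared norms of the rows with respect to the empirical measures of
the first `n` observations. -/
def SqUniformlyIntegrable (x : ℕ → Fin p → ℝ) : Prop :=
  ∀ δ : ℝ, 0 < δ → ∃ B : ℝ, ∀ n : ℕ,
    (∑ i ∈ Finset.range n, if B < ∑ j, x i j ^ 2 then ∑ j, x i j ^ 2 else 0) ≤ δ * n

lemma exists_sum_sq_le {x : ℕ → Fin p → ℝ}
    (hUI : SqUniformlyIntegrable x) :
    ∃ L : ℝ, 0 ≤ L ∧ ∀ n : ℕ, ∑ i : Fin n, ∑ j, x i j ^ 2 ≤ L * n := by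
  obtain ⟨B, hB⟩ := hUI 1 one_pos
  refine ⟨max B 0 + 1, by positivity, fun n => ?_⟩
  rw [Fin.sum_univ_eq_sum_range (fun i => ∑ j, x i j ^ 2) n]
  calc ∑ i ∈ Finset.range n, ∑ j, x i j ^ 2
      ≤ ∑ i ∈ Finset.range n,
        (max B 0 + if B < ∑ j, x i j ^ 2 then ∑ j, x i j ^ 2 else 0) := by
        refine Finset.sum_le_sum fun i _ => ?_
        split_ifs with h
        · linarith [le_max_right B 0]
        · linarith [le_max_left B 0, not_lt.1 h]
    _ ≤ (max B 0 + 1) * n := by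
        rw [Finset.sum_add_distrib]
        have := hB n
        simp only [Finset.sum_const, Finset.card_range, nsmul_eq_mul]
        linarith

/-- The observations among the first `n` whose covariates have squared norm at most `B`. -/
def boundedRows (x : ℕ → Fin p → ℝ) (n : ℕ) (B : ℝ) : Finset (Fin n) :=
  Finset.univ.filter fun i : Fin n => ∑ j, x i j ^ 2 ≤ B

lemma mem_boundedRows {x : ℕ → Fin p → ℝ} {n : ℕ} {B : ℝ} {i : Fin n} :
    i ∈ boundedRows x n B ↔ ∑ j, x i j ^ 2 ≤ B := by
  simp [boundedRows]

lemma exists_sum_large_le {x : ℕ → Fin p → ℝ}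
    (hUI : SqUniformlyIntegrable x)
    {δ : ℝ} (hδ : 0 < δ) :
    ∃ B : ℝ, 0 ≤ B ∧ ∀ n : ℕ,
      ∑ i ∈ (boundedRows x n B)ᶜ, (1 + ∑ j, x i j ^ 2) ≤ δ * n := by
  obtain ⟨B, hB⟩ := hUI (δ / 2) (half_pos hδ)
  refine ⟨max B 1, by positivity, fun n => ?_⟩
  have h : ∑ i ∈ (boundedRows x n (max B 1))ᶜ, (1 + ∑ j, x i j ^ 2) ≤
      2 * ∑ i : Fin n, if B < ∑ j, x i j ^ 2 then ∑ j, x i j ^ 2 else 0 := by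
    rw [boundedRows, Finset.compl_filter, Finset.sum_filter, Finset.mul_sum]
    refine Finset.sum_le_sum fun i _ => ?_
    have h0 : 0 ≤ ∑ j, x i j ^ 2 := Finset.sum_nonneg fun _ _ => sq_nonneg _
    split_ifs with h1 h2 h2
    · linarith
    · linarith
    · rw [not_le, max_lt_iff] at h1
      linarith
    · rw [not_le, max_lt_iff] at h1
      exact absurd h1.1 h2
  rw [Fin.sum_univ_eq_sum_range
    (fun i => if B < ∑ j, x i j ^ 2 then ∑ j, x i j ^ 2 else 0) n] at h
  linarith [hB n]

lemma sum_mean_sq_le {x : ℕ → Fin p → ℝ} {L : ℝ} (hL0 : 0 ≤ L) {n : ℕ}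
    (hL : ∑ i : Fin n, ∑ j, x i j ^ 2 ≤ L * n) :
    ∑ j, ((∑ l : Fin n, x l j) / n) ^ 2 ≤ L := by
  rcases Nat.eq_zero_or_pos n with rfl | hn
  · simpa using hL0
  have hn' : (0 : ℝ) < n := by positivity
  have h : ∀ j, ((∑ l : Fin n, x l j) / n) ^ 2 ≤ (∑ l : Fin n, x l j ^ 2) / n := fun j => by
    have := sq_sum_le_card_mul_sum_sq (s := Finset.univ) (f := fun l : Fin n => x l j)
    simp only [Finset.card_univ, Fintype.card_fin] at this
    rw [div_pow, div_le_div_iff₀ (by positivity) hn']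
    nlinarith
  calc ∑ j, ((∑ l : Fin n, x l j) / n) ^ 2 ≤ ∑ j, (∑ l : Fin n, x l j ^ 2) / n :=
        Finset.sum_le_sum fun j _ => h j
    _ = (∑ i : Fin n, ∑ j, x i j ^ 2) / n := by rw [← Finset.sum_div, Finset.sum_comm]
    _ ≤ L := by rwa [div_le_iff₀ hn']

lemma sum_centered_sq_le {x : ℕ → Fin p → ℝ} {L : ℝ} (hL0 : 0 ≤ L) {n : ℕ}
    (hL : ∑ i : Fin n, ∑ j, x i j ^ 2 ≤ L * n) (i : Fin n) :
    ∑ j, centered x n i j ^ 2 ≤ 2 * ∑ j, x i j ^ 2 + 2 * L := by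
  have h := sum_mean_sq_le hL0 hL
  calc ∑ j, centered x n i j ^ 2
      ≤ ∑ j, (2 * x i j ^ 2 + 2 * ((∑ l : Fin n, x l j) / n) ^ 2) := by
        refine Finset.sum_le_sum fun j _ => ?_
        rw [centered]
        nlinarith [sq_nonneg (x i j + (∑ l : Fin n, x l j) / n)]
    _ = 2 * ∑ j, x i j ^ 2 + 2 * ∑ j, ((∑ l : Fin n, x l j) / n) ^ 2 := by
        rw [Finset.sum_add_distrib, Finset.mul_sum, Finset.mul_sum]
    _ ≤ _ := by linarith

lemma sum_subtype_le_sum (k : Finset (Fin p)) {f : Fin p → ℝ} (hf : ∀ j, 0 ≤ f j) :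
    ∑ j : k, f j ≤ ∑ j, f j := by
  rw [Finset.sum_coe_sort k f]
  exact Finset.sum_le_sum_of_subset_of_nonneg (Finset.subset_univ k) fun j _ _ => hf j

lemma sum_design_sq_le {x : ℕ → Fin p → ℝ} {L : ℝ} (hL0 : 0 ≤ L) {n : ℕ}
    (hL : ∑ i : Fin n, ∑ j, x i j ^ 2 ≤ L * n) (k : Finset (Fin p)) (i : Fin n) :
    ∑ j, design x n k i j ^ 2 ≤ 2 * ∑ j, x i j ^ 2 + 2 * L :=
  (sum_subtype_le_sum k fun j => sq_nonneg (centered x n i j)).trans (sum_centered_sq_le hL0 hL i)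

lemma sum_linPred_sq {n : ℕ} {ι : Type} [Fintype ι] {X : Matrix (Fin n) ι ℝ}
    (hX : ∀ j, ∑ i, X i j = 0) (a : ℝ) (b : ι → ℝ) :
    ∑ i, linPred X a b i ^ 2 = n * a ^ 2 + (X *ᵥ b) ⬝ᵥ (X *ᵥ b) := by
  have h := sum_mulVec_eq_zero hX b
  simp only [linPred, add_sq, Finset.sum_add_distrib, ← Finset.mul_sum, h, dotProduct, ← sq]
  simp

/-- Uniform integrability keeps half of the smallest eigenvalue of the Gram matrix when the rows
with large covariates are dropped. -/
lemma exists_bounded_rows_curvature {x : ℕ → Fin p → ℝ}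
    (hUI : SqUniformlyIntegrable x)
    {K : Finset (Fin p)} {r : ℝ} (hr : 0 < r)
    (hGram : ∀ᶠ n : ℕ in atTop, ∀ v : K → ℝ,
      r * n * (v ⬝ᵥ v) ≤ (design x n K *ᵥ v) ⬝ᵥ (design x n K *ᵥ v)) :
    ∃ B : ℝ, 0 ≤ B ∧ ∃ ρ : ℝ, 0 < ρ ∧ ∀ᶠ n : ℕ in atTop, ∀ (a : ℝ) (b : K → ℝ),
      ρ * n * (a ^ 2 + ∑ j, b j ^ 2) ≤
        ∑ i ∈ boundedRows x n B, linPred (design x n K) a b i ^ 2 := by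
  obtain ⟨L, hL0, hL⟩ := exists_sum_sq_le hUI
  have hr1 : 0 < min 1 r := lt_min one_pos hr
  obtain ⟨B, hB0, hB⟩ := exists_sum_large_le hUI (δ := min 1 r / (4 + 4 * L)) (by positivity)
  refine ⟨B, hB0, min 1 r / 2, half_pos hr1, hGram.mono fun n hn a b => ?_⟩
  set N := a ^ 2 + ∑ j, b j ^ 2 with hN
  have hb0 : 0 ≤ ∑ j, b j ^ 2 := Finset.sum_nonneg fun _ _ => sq_nonneg _
  have hN0 : 0 ≤ N := by positivity
  have hn0 : (0 : ℝ) ≤ n := Nat.cast_nonneg n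
  have htot : min 1 r * n * N ≤ ∑ i, linPred (design x n K) a b i ^ 2 := by
    rw [sum_linPred_sq (sum_design x K)]
    have h1 := hn b
    have h2 : b ⬝ᵥ b = ∑ j, b j ^ 2 := by simp [dotProduct, sq]
    rw [h2] at h1
    have h3 : min 1 r * (n * a ^ 2) ≤ 1 * (n * a ^ 2) := by
      gcongr
      exact min_le_left _ _
    have h4 : min 1 r * (n * ∑ j, b j ^ 2) ≤ r * (n * ∑ j, b j ^ 2) := by
      gcongr
      exact min_le_right _ _
    rw [hN]
    linarith
  have hbad : ∑ i ∈ (boundedRows x n B)ᶜ, linPred (design x n K) a b i ^ 2 ≤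
      min 1 r / 2 * n * N := by
    calc ∑ i ∈ (boundedRows x n B)ᶜ, linPred (design x n K) a b i ^ 2
        ≤ ∑ i ∈ (boundedRows x n B)ᶜ, (2 + 2 * L) * N * (1 + ∑ j, x i j ^ 2) := by
          refine Finset.sum_le_sum fun i _ => (linPred_sq_le _ a b i).trans ?_
          have h1 := sum_design_sq_le hL0 (hL n) K i
          have h2 : 0 ≤ ∑ j, x i j ^ 2 := Finset.sum_nonneg fun _ _ => sq_nonneg _
          calc (1 + ∑ j, design x n K i j ^ 2) * N
              ≤ ((2 + 2 * L) * (1 + ∑ j, x i j ^ 2)) * N := by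
                gcongr
                nlinarith
            _ = _ := by ring
      _ ≤ (2 + 2 * L) * N * (min 1 r / (4 + 4 * L) * n) := by
          rw [← Finset.mul_sum]
          exact mul_le_mul_of_nonneg_left (hB n) (by positivity)
      _ = min 1 r / 2 * n * N := by
          field_simp
          ring
  have hsplit := Finset.sum_add_sum_compl (boundedRows x n B) fun i =>
    linPred (design x n K) a b i ^ 2
  linarith

lemma abs_trueLinPred_le (x : ℕ → Fin p → ℝ) (a₀ : ℝ) (b₀ : Fin p → ℝ) {n : ℕ} {B : ℝ} {i : Fin n}
    (hi : ∑ j, x i j ^ 2 ≤ B) :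
    |trueLinPred x a₀ b₀ n i| ≤ √((1 + B) * (a₀ ^ 2 + ∑ j, b₀ j ^ 2)) := by
  have h := linPred_sq_le (Matrix.of fun (i : Fin n) j => x i j) a₀ b₀ i
  refine Real.abs_le_sqrt (h.trans ?_)
  simp only [Matrix.of_apply]
  gcongr

/-- The squared length of the score of the model with all (centered) covariates. -/
def scoreSq (x : ℕ → Fin p → ℝ) (n : ℕ) (w : Fin n → ℝ) : ℝ :=
  (∑ i, w i) ^ 2 + ∑ j, (∑ i, w i * centered x n i j) ^ 2

/-- A bound on the log-likelihood ratio of model `k` against the truth when the score has squared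
length at most `C² n`: at most a constant everywhere, and, away from the truth by `u`, negative of
order `n`. -/
def LogLikRatioBound (x : ℕ → Fin p → ℝ) (a₀ : ℝ) (b₀ : Fin p → ℝ) (k : Finset (Fin p))
    (κ C : ℝ) (n : ℕ) : Prop :=
  ∀ y : Fin n → Bool, scoreSq x n (score y (trueLinPred x a₀ b₀ n)) ≤ C ^ 2 * n →
    ∀ (a : ℝ) (b : k → ℝ),
      logLik y (linPred (design x n k) a b) ≤
        logLik y (trueLinPred x a₀ b₀ n) + C ^ 2 / (4 * κ) ∧
      ∀ u : ℝ, 0 < u → u ≤ 1 → u ≤ paramDist x a₀ b₀ n k a b →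
        logLik y (linPred (design x n k) a b) ≤ logLik y (trueLinPred x a₀ b₀ n) +
          paramDist x a₀ b₀ n k a b * (C * √n - κ * n * u)

lemma eventually_mul_sqrt_le (C : ℝ) {c : ℝ} (hc : 0 < c) :
    ∀ᶠ n : ℕ in atTop, C * √n ≤ c * n := by
  filter_upwards [eventually_ge_atTop ⌈(C / c) ^ 2⌉₊] with n hn
  have h1 : C / c ≤ √n := Real.le_sqrt_of_sq_le (Nat.ceil_le.1 hn)
  rw [div_le_iff₀ hc] at h1
  calc C * √n ≤ √n * c * √n := by gcongr
    _ = c * (√n * √n) := by ring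
    _ = c * n := by rw [Real.mul_self_sqrt (Nat.cast_nonneg n)]

lemma exists_logLikRatioBound {x : ℕ → Fin p → ℝ} (a₀ : ℝ) {b₀ : Fin p → ℝ}
    (hUI : SqUniformlyIntegrable x)
    {k K : Finset (Fin p)} (hkK : k ⊆ K) (hb₀ : ∀ j ∉ K, b₀ j = 0) {r : ℝ} (hr : 0 < r)
    (hGram : ∀ᶠ n : ℕ in atTop, ∀ v : K → ℝ,
      r * n * (v ⬝ᵥ v) ≤ (design x n K *ᵥ v) ⬝ᵥ (design x n K *ᵥ v)) :
    ∃ κ : ℝ, 0 < κ ∧ ∀ C : ℝ, 0 ≤ C → ∀ᶠ n : ℕ in atTop, LogLikRatioBound x a₀ b₀ k κ C n := by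
  obtain ⟨L, hL0, hL⟩ := exists_sum_sq_le hUI
  obtain ⟨B, hB0, ρ, hρ, hcurv⟩ := exists_bounded_rows_curvature hUI hr hGram
  set T := √((1 + B) * (a₀ ^ 2 + ∑ j, b₀ j ^ 2))
  set W := √(1 + (2 * B + 2 * L))
  obtain ⟨m, hm0, hm⟩ := exists_log_Phi_le_tangent_sub_sq (T + W)
  have hκ : 0 < m * ρ := mul_pos hm0 hρ
  refine ⟨m * ρ, hκ, fun C hC0 => ?_⟩
  filter_upwards [hcurv, eventually_mul_sqrt_le C hκ, eventually_gt_atTop 0] with n hcn hln hn0 y hy a b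
  have hn : (0 : ℝ) < n := by exact_mod_cast hn0
  have hloc : ∀ (a : ℝ) (b : K → ℝ) (N : ℝ), 0 ≤ N → a ^ 2 + ∑ j, b j ^ 2 = N ^ 2 → N ≤ 1 →
      logLik y (trueLinPred x a₀ b₀ n + linPred (design x n K) a b) ≤
        logLik y (trueLinPred x a₀ b₀ n) + C * √n * N - m * ρ * n * N ^ 2 := by
    intro a b N hN0 hN hN1
    have h := logLik_add_linPred_le y (trueLinPred x a₀ b₀ n) (design x n K)
      (boundedRows x n B) (W := W) (K := ρ * n) (S := C * √n) (Real.sqrt_nonneg _)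
      hm0.le hm (fun i hi => abs_trueLinPred_le x a₀ b₀ (mem_boundedRows.1 hi))
      (fun i hi => ?_) hcn (by positivity) ?_ hN0 hN hN1
    · linarith
    · rw [Real.sq_sqrt (by positivity)]
      have := sum_design_sq_le hL0 (hL n) K i
      linarith [mem_boundedRows.1 hi]
    · rw [mul_pow, Real.sq_sqrt hn.le]
      refine le_trans ?_ hy
      rw [scoreSq]
      gcongr
      exact sum_subtype_le_sum K (f := fun j =>
        (∑ i, score y (trueLinPred x a₀ b₀ n) i * centered x n i j) ^ 2) fun j => sq_nonneg _
  rw [linPred_design_eq_add x a₀ n hkK hb₀]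
  have hN := sq_add_sum_sq_eq_paramDist_sq x a₀ n hkK hb₀ a b
  have hN0 := paramDist_nonneg x a₀ b₀ n k a b
  set N := paramDist x a₀ b₀ n k a b
  refine ⟨?_, fun u hu0 hu1 huN => ?_⟩
  · rcases le_total N 1 with hN1 | hN1
    · have h1 := hloc _ _ N hN0 hN hN1
      have h2 : C * √n * N - m * ρ * n * N ^ 2 ≤ C ^ 2 / (4 * (m * ρ)) := by
        have h3 : C * √n * N - m * ρ * n * N ^ 2 = C * (√n * N) - m * ρ * (√n * N) ^ 2 := by
          rw [mul_pow, Real.sq_sqrt hn.le]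
          ring
        rw [h3, le_div_iff₀ (by positivity)]
        nlinarith [sq_nonneg (C - 2 * (m * ρ) * (√n * N))]
      linarith
    · have h1 := logLik_add_linPred_le_of_le y _ _ hloc hN one_pos le_rfl hN1
      have h2 : N * (C * √n - m * ρ * n * 1) ≤ 0 :=
        mul_nonpos_of_nonneg_of_nonpos hN0 (by linarith)
      have h3 : 0 ≤ C ^ 2 / (4 * (m * ρ)) := by positivity
      linarith
  · exact logLik_add_linPred_le_of_le y _ _ hloc hN hu0 hu1 huN

end Design

/-! ### Existence of the maximizer and comparison of models -/

section Comparison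

variable {p : ℕ}

lemma penLogLik_le_logLik {n : ℕ} {ι : Type} [Fintype ι] (X : Matrix (Fin n) ι ℝ)
    (y : Fin n → Bool) (a : ℝ) (b : ι → ℝ) : penLogLik n X y a b ≤ logLik y (linPred X a b) := by
  have h : 0 ≤ (X *ᵥ b) ⬝ᵥ (X *ᵥ b) := Finset.sum_nonneg fun _ _ => mul_self_nonneg _
  rw [penLogLik, sub_le_self_iff]
  positivity

lemma penLogLik_zero {n : ℕ} {ι : Type} [Fintype ι] (X : Matrix (Fin n) ι ℝ) (y : Fin n → Bool) :
    penLogLik n X y 0 0 = -(n * Real.log 2) := by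
  have h : linPred X 0 0 = 0 := by
    ext i
    simp [linPred]
  simp [penLogLik, h, logLik_zero]

lemma continuous_penLogLik {n : ℕ} {ι : Type} [Fintype ι] (g : ℝ) (X : Matrix (Fin n) ι ℝ)
    (y : Fin n → Bool) : Continuous fun θ : ℝ × (ι → ℝ) => penLogLik g X y θ.1 θ.2 := by
  have h1 : Continuous fun θ : ℝ × (ι → ℝ) => linPred X θ.1 θ.2 := by
    refine continuous_pi fun i => ?_
    simp only [linPred, Matrix.mulVec, dotProduct]
    fun_prop
  have h2 : Continuous fun θ : ℝ × (ι → ℝ) => (X *ᵥ θ.2) ⬝ᵥ (X *ᵥ θ.2) / (2 * g) := by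
    simp only [Matrix.mulVec, dotProduct]
    fun_prop
  exact ((continuous_logLik y).comp h1).sub h2

/-- At distance more than `max 1 (2 log 2 / κ)` from the truth the penalized log-likelihood is below
`-n log 2`, its value at the origin. -/
lemma LogLikRatioBound.exists_isMax {x : ℕ → Fin p → ℝ} {a₀ : ℝ} {b₀ : Fin p → ℝ}
    {k : Finset (Fin p)} {κ C : ℝ} {n : ℕ} (h : LogLikRatioBound x a₀ b₀ k κ C n) (hκ : 0 < κ)
    (hn : 0 < n) (hC : C * √n ≤ κ / 2 * n) {y : Fin n → Bool}
    (hy : scoreSq x n (score y (trueLinPred x a₀ b₀ n)) ≤ C ^ 2 * n) :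
    ∃ (a : ℝ) (b : k → ℝ),
      (∀ a' b', penLogLik n (design x n k) y a' b' ≤ penLogLik n (design x n k) y a b) ∧
      paramDist x a₀ b₀ n k a b ≤ max 1 (2 * Real.log 2 / κ) := by
  have hn' : (0 : ℝ) < n := by exact_mod_cast hn
  set R := max 1 (2 * Real.log 2 / κ) with hR
  have hR0 : 0 ≤ R := zero_le_one.trans (le_max_left _ _)
  have hfar : ∀ (a : ℝ) (b : k → ℝ), R < paramDist x a₀ b₀ n k a b →
      penLogLik n (design x n k) y a b < penLogLik n (design x n k) y 0 0 := fun a b hab => by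
    have h1 := (h y hy a b).2 1 one_pos le_rfl ((le_max_left _ _).trans hab.le)
    have h2 := penLogLik_le_logLik (design x n k) y a b
    have h3 := logLik_nonpos y (trueLinPred x a₀ b₀ n)
    have h4 : 2 * Real.log 2 < paramDist x a₀ b₀ n k a b * κ :=
      (div_lt_iff₀ hκ).1 ((le_max_right _ _).trans_lt hab)
    have h5 := mul_le_mul_of_nonneg_left hC (paramDist_nonneg x a₀ b₀ n k a b)
    rw [penLogLik_zero]
    nlinarith
  obtain ⟨θ, hθ⟩ := (continuous_penLogLik n (design x n k) y).exists_forall_ge' (0, 0) (by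
    have hK := (isCompact_closedBall
      ((centeredIntercept x a₀ b₀ n, fun j => b₀ j) : ℝ × (k → ℝ)) R).compl_mem_cocompact
    filter_upwards [hK] with θ hθ
    refine (hfar θ.1 θ.2 (lt_of_not_ge fun hle => hθ ?_)).le
    rw [Metric.mem_closedBall, Prod.dist_eq]
    refine max_le ((abs_intercept_sub_le_paramDist x a₀ b₀ n k θ.1 θ.2).trans hle) ?_
    refine (dist_pi_le_iff hR0).2 fun j => ?_
    have := abs_slope_sub_le_paramDist x a₀ b₀ n k θ.1 θ.2 j
    rw [extendZero_apply] at this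
    exact this.trans hle)
  refine ⟨θ.1, θ.2, fun a' b' => hθ (a', b'), not_lt.1 fun hlt => ?_⟩
  exact absurd (hθ (0, 0)) (not_le.2 (hfar _ _ hlt))

lemma design_mulVec_extendZero (x : ℕ → Fin p → ℝ) (n : ℕ) {k K : Finset (Fin p)} (hkK : k ⊆ K)
    (v : k → ℝ) : design x n K *ᵥ (fun j : K => extendZero k v j) = design x n k *ᵥ v := by
  have h := linPred_design_eq_add x 0 (b₀ := 0) n hkK (by simp) 0 v
  ext i
  have hi := congrFun h i
  simp [linPred, trueLinPred, centeredIntercept] at hi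
  exact hi.symm

/-- Full rank is inherited from a supermodel. -/
lemma isUnit_det_design {x : ℕ → Fin p → ℝ} {n : ℕ} (hn : 0 < n) {k K : Finset (Fin p)}
    (hkK : k ⊆ K) {r : ℝ} (hr : 0 < r) (hGram : ∀ v : K → ℝ,
      r * n * (v ⬝ᵥ v) ≤ (design x n K *ᵥ v) ⬝ᵥ (design x n K *ᵥ v)) :
    IsUnit ((design x n k)ᵀ * design x n k).det := by
  have hn' : (0 : ℝ) < n := by exact_mod_cast hn
  rw [isUnit_iff_ne_zero]
  intro h0
  obtain ⟨v, hv, hXv⟩ := Matrix.exists_mulVec_eq_zero_iff.2 h0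
  refine hv ?_
  have h1 : (design x n k *ᵥ v) ⬝ᵥ (design x n k *ᵥ v) = 0 := by
    rw [Matrix.dotProduct_mulVec, ← Matrix.mulVec_transpose, Matrix.mulVec_mulVec, hXv,
      zero_dotProduct]
  have h2 := hGram fun j => extendZero k v j
  rw [design_mulVec_extendZero x n hkK, h1] at h2
  have h3 : (fun j : K => extendZero k v j) ⬝ᵥ (fun j : K => extendZero k v j) = 0 :=
    le_antisymm (nonpos_of_mul_nonpos_right h2 (by positivity))
      (Finset.sum_nonneg fun _ _ => mul_self_nonneg _)
  rw [dotProduct_self_eq_zero] at h3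
  ext j
  have := congrFun h3 ⟨j, hkK j.2⟩
  simpa [extendZero_apply] using this

/-- The penalty is bounded near the truth: the factor `g = n` in the prior covariance compensates
the growth of the Gram matrix. -/
lemma penalty_le {x : ℕ → Fin p → ℝ} {L : ℝ} (hL0 : 0 ≤ L) {n : ℕ} (hn : 0 < n)
    (hL : ∑ i : Fin n, ∑ j, x i j ^ 2 ≤ L * n) {a₀ : ℝ} {b₀ : Fin p → ℝ} {k : Finset (Fin p)}
    {a : ℝ} {b : k → ℝ} {R : ℝ} (hR : paramDist x a₀ b₀ n k a b ≤ R) :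
    (design x n k *ᵥ b) ⬝ᵥ (design x n k *ᵥ b) / (2 * n) ≤ 2 * L * ∑ j, (R + |b₀ j|) ^ 2 := by
  have hn' : (0 : ℝ) < n := by exact_mod_cast hn
  have hb : ∑ j, b j ^ 2 ≤ ∑ j, (R + |b₀ j|) ^ 2 := by
    refine le_trans ?_ (sum_subtype_le_sum k (f := fun j => (R + |b₀ j|) ^ 2) fun _ => sq_nonneg _)
    refine Finset.sum_le_sum fun j _ => sq_le_sq' ?_ ?_
    all_goals
      have h1 := (abs_slope_sub_le_paramDist x a₀ b₀ n k a b j).trans hR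
      rw [extendZero_apply] at h1
      have h2 := abs_le.1 h1
      have h3 := neg_abs_le (b₀ j)
      have h4 := le_abs_self (b₀ j)
      linarith [h2.1, h2.2]
  rw [div_le_iff₀ (by positivity)]
  calc (design x n k *ᵥ b) ⬝ᵥ (design x n k *ᵥ b)
      ≤ ∑ i : Fin n, (2 * ∑ j, x i j ^ 2 + 2 * L) * ∑ j, b j ^ 2 := by
        refine Finset.sum_le_sum fun i _ => ?_
        have h1 := Finset.sum_mul_sq_le_sq_mul_sq Finset.univ (design x n k i) b
        have h2 := sum_design_sq_le hL0 hL k i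
        rw [← sq]
        exact h1.trans (by gcongr)
    _ = (2 * ∑ i : Fin n, ∑ j, x i j ^ 2 + n * (2 * L)) * ∑ j, b j ^ 2 := by
        rw [← Finset.sum_mul, Finset.sum_add_distrib, ← Finset.mul_sum]
        simp
    _ ≤ (2 * (L * n) + n * (2 * L)) * ∑ j, (R + |b₀ j|) ^ 2 := by gcongr
    _ = 2 * L * (∑ j, (R + |b₀ j|) ^ 2) * (2 * n) := by ring

lemma exists_unique_isVBSolution {n : ℕ} (hn : 0 < n) {ι : Type} [Fintype ι] [DecidableEq ι]
    {X : Matrix (Fin n) ι ℝ} (hX : ∀ j, ∑ i, X i j = 0) (hdet : IsUnit (Xᵀ * X).det)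
    {y : Fin n → Bool} {a : ℝ} {b : ι → ℝ}
    (hmax : ∀ a' b', penLogLik n X y a' b' ≤ penLogLik n X y a b) :
    ∃ q : VBParams ι, q.muA = a ∧ q.muB = b ∧ ∀ q', IsVBSolution (n : ℝ) X y q' ↔ q' = q := by
  have hn' : (0 : ℝ) < n := by exact_mod_cast hn
  refine ⟨⟨a, (n : ℝ≥0)⁻¹, b, ((n : ℝ) / (1 + n)) • (Xᵀ * X)⁻¹⟩, rfl, rfl, fun q' => ?_⟩
  have hst := isStationary_of_isMax hn' hmax
  rw [isVBSolution_iff hn' hn hX hdet]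
  constructor
  · rintro ⟨h, h1, h2⟩
    obtain ⟨h3, h4⟩ := h.unique hn' hn hX hdet hst
    cases q'
    simp_all
  · rintro rfl
    exact ⟨hst, rfl, rfl⟩

lemma eventually_add_mul_log_lt (D q : ℝ) (hq : 0 ≤ q) {c : ℝ} (hc : 0 < c) :
    ∀ᶠ n : ℕ in atTop, D + q * Real.log (1 + n) < c * n := by
  have ht : Tendsto (fun n : ℕ => 1 + (n : ℝ)) atTop atTop :=
    tendsto_atTop_add_const_left _ 1 tendsto_natCast_atTop_atTop
  have h := (Real.isLittleO_log_id_atTop.comp_tendsto ht).bound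
    (c := c / (2 * (q + 1))) (by positivity)
  filter_upwards [h, eventually_gt_atTop ⌈(D + c / 2) / (c / 2)⌉₊] with n hn hn2
  have h1 : Real.log (1 + n) ≤ c / (2 * (q + 1)) * (1 + n) := by
    have h2 := (le_abs_self _).trans hn
    simpa [abs_of_pos (show (0 : ℝ) < 1 + n by positivity)] using h2
  have h3 : D + c / 2 < n * (c / 2) := (div_lt_iff₀ (half_pos hc)).1 (Nat.lt_of_ceil_lt hn2)
  have h4 : q * (c / (2 * (q + 1)) * (1 + n)) ≤ c / 2 * (1 + n) := by
    have : q * (c / (2 * (q + 1))) ≤ c / 2 := by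
      rw [mul_div_assoc', div_le_div_iff₀ (by positivity) (by positivity)]
      nlinarith
    calc _ = q * (c / (2 * (q + 1))) * (1 + n) := by ring
      _ ≤ _ := by gcongr
  have h5 := mul_le_mul_of_nonneg_left h1 hq
  linarith

/-- Either `k` strictly contains the true model, and the constant gained in the log-likelihood is
outweighed by the `log n` for the additional parameters, or `k` misses a coefficient, and stays away
from the truth by a fixed distance. -/
lemma eventually_logLik_sub_lt {x : ℕ → Fin p → ℝ} {a₀ : ℝ} {b₀ : Fin p → ℝ}
    {k k₀ : Finset (Fin p)} (hk₀ : ∀ j, j ∈ k₀ ↔ b₀ j ≠ 0) (hk : k ≠ k₀) {κ C : ℝ} (hκ : 0 < κ)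
    (h : ∀ᶠ n in atTop, LogLikRatioBound x a₀ b₀ k κ C n) (D : ℝ) :
    ∀ᶠ n : ℕ in atTop, ∀ y : Fin n → Bool,
      scoreSq x n (score y (trueLinPred x a₀ b₀ n)) ≤ C ^ 2 * n → ∀ (a : ℝ) (b : k → ℝ),
      logLik y (linPred (design x n k) a b) - (k.card : ℝ) / 2 * Real.log (1 + n) <
        logLik y (trueLinPred x a₀ b₀ n) - D - (k₀.card : ℝ) / 2 * Real.log (1 + n) := by
  by_cases hsub : k₀ ⊆ k
  · have hcard : (k₀.card : ℝ) + 1 ≤ k.card := by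
      exact_mod_cast Finset.card_lt_card (hsub.ssubset_of_ne hk.symm)
    have ht : Tendsto (fun n : ℕ => Real.log (1 + n)) atTop atTop :=
      Real.tendsto_log_atTop.comp
        (tendsto_atTop_add_const_left _ 1 tendsto_natCast_atTop_atTop)
    filter_upwards [h, ht.eventually_gt_atTop (2 * (C ^ 2 / (4 * κ) + D)),
      ht.eventually_ge_atTop 0] with n hn hlog hlog0 y hy a b
    have h1 := (hn y hy a b).1
    nlinarith
  · obtain ⟨j, hj₀, hjk⟩ := Finset.not_subset.1 hsub
    set u := min 1 |b₀ j|
    have hu0 : 0 < u := lt_min one_pos (abs_pos.2 ((hk₀ j).1 hj₀))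
    filter_upwards [h, eventually_mul_sqrt_le C (show 0 < κ * u / 2 by positivity),
      eventually_add_mul_log_lt D ((k₀.card : ℝ) / 2) (by positivity)
        (show 0 < u * (κ * u / 2) by positivity)] with n hn hC hlog y hy a b
    have hdist : u ≤ paramDist x a₀ b₀ n k a b := by
      have h1 := abs_slope_sub_le_paramDist x a₀ b₀ n k a b j
      rw [extendZero_of_notMem _ hjk, zero_sub, abs_neg] at h1
      exact (min_le_right _ _).trans h1
    have h1 := (hn y hy a b).2 u hu0 (min_le_left _ _) hdist
    have hlog0 : 0 ≤ Real.log (1 + n) := Real.log_nonneg (by simp)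
    have h2 : 0 ≤ (k.card : ℝ) / 2 * Real.log (1 + n) := by positivity
    have hnn : (0 : ℝ) ≤ n := Nat.cast_nonneg n
    have h3 : paramDist x a₀ b₀ n k a b * (C * √n - κ * n * u) ≤
        u * (-(κ * u / 2 * n)) :=
      calc paramDist x a₀ b₀ n k a b * (C * √n - κ * n * u)
          ≤ paramDist x a₀ b₀ n k a b * (-(κ * u / 2 * n)) :=
            mul_le_mul_of_nonneg_left (by linarith) (paramDist_nonneg x a₀ b₀ n k a b)
        _ ≤ u * (-(κ * u / 2 * n)) :=
            mul_le_mul_of_nonpos_right hdist (neg_nonpos.2 (by positivity))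
    linarith

/-- All that is asked of the fit of model `k` to the outcomes `y`: the variational solution is
unique, it maximizes the penalized log-likelihood with penalty at most `D`, and, unless `k` is the
true model `k₀`, its criterion exceeds the one at the true parameters, whose penalty is at most
`D₀`. -/
structure GoodFit (x : ℕ → Fin p → ℝ) (a₀ : ℝ) (b₀ : Fin p → ℝ) (k₀ : Finset (Fin p)) (D₀ D : ℝ)
    {n : ℕ} (y : Fin n → Bool) (k : Finset (Fin p)) (q : VBParams k) : Prop where
  unique : ∀ q', IsVBSolution (n : ℝ) (design x n k) y q' ↔ q' = q
  isMax : ∀ a b, penLogLik n (design x n k) y a b ≤ penLogLik n (design x n k) y q.muA q.muB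
  penalty_le : (design x n k *ᵥ q.muB) ⬝ᵥ (design x n k *ᵥ q.muB) / (2 * n) ≤ D
  lt_of_ne : k ≠ k₀ →
    penLogLik n (design x n k) y q.muA q.muB - (k.card : ℝ) / 2 * Real.log (1 + n) <
      logLik y (trueLinPred x a₀ b₀ n) - D₀ - (k₀.card : ℝ) / 2 * Real.log (1 + n)

lemma exists_goodFit {x : ℕ → Fin p → ℝ} (a₀ : ℝ) {b₀ : Fin p → ℝ}
    (hUI : SqUniformlyIntegrable x) {k k₀ : Finset (Fin p)} (hk₀ : ∀ j, j ∈ k₀ ↔ b₀ j ≠ 0)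
    {r : ℝ} (hr : 0 < r) (hGram : ∀ᶠ n : ℕ in atTop, ∀ v : ↥(k ∪ k₀) → ℝ,
      r * n * (v ⬝ᵥ v) ≤ (design x n (k ∪ k₀) *ᵥ v) ⬝ᵥ (design x n (k ∪ k₀) *ᵥ v)) (D₀ : ℝ) :
    ∃ D : ℝ, ∀ C : ℝ, 0 ≤ C → ∀ᶠ n : ℕ in atTop, ∀ y : Fin n → Bool,
      scoreSq x n (score y (trueLinPred x a₀ b₀ n)) ≤ C ^ 2 * n →
      ∃ q : VBParams k, GoodFit x a₀ b₀ k₀ D₀ D y k q := by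
  have hkK : k ⊆ k ∪ k₀ := Finset.subset_union_left
  have hb₀ : ∀ j ∉ k ∪ k₀, b₀ j = 0 := fun j hj => by
    by_contra h
    exact hj (Finset.mem_union_right _ ((hk₀ j).2 h))
  obtain ⟨L, hL0, hL⟩ := exists_sum_sq_le hUI
  obtain ⟨κ, hκ, hbound⟩ := exists_logLikRatioBound a₀ hUI hkK hb₀ hr hGram
  refine ⟨2 * L * ∑ j, (max 1 (2 * Real.log 2 / κ) + |b₀ j|) ^ 2, fun C hC => ?_⟩
  have hlt : ∀ᶠ n : ℕ in atTop, k ≠ k₀ → ∀ y : Fin n → Bool,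
      scoreSq x n (score y (trueLinPred x a₀ b₀ n)) ≤ C ^ 2 * n → ∀ (a : ℝ) (b : k → ℝ),
      logLik y (linPred (design x n k) a b) - (k.card : ℝ) / 2 * Real.log (1 + n) <
        logLik y (trueLinPred x a₀ b₀ n) - D₀ - (k₀.card : ℝ) / 2 * Real.log (1 + n) := by
    by_cases hk : k = k₀
    · exact Eventually.of_forall fun n h => absurd hk h
    · exact (eventually_logLik_sub_lt hk₀ hk hκ (hbound C hC) D₀).mono fun n h _ => h
  filter_upwards [hbound C hC, hGram, eventually_gt_atTop 0,
    eventually_mul_sqrt_le C (half_pos hκ), hlt] with n hn hG hn0 hCn hltn y hy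
  obtain ⟨a, b, hmax, hdist⟩ := hn.exists_isMax hκ hn0 hCn hy
  obtain ⟨q, rfl, rfl, hq⟩ := exists_unique_isVBSolution hn0 (sum_design x k)
    (isUnit_det_design hn0 hkK hr hG) hmax
  refine ⟨q, hq, hmax, penalty_le hL0 hn0 (hL n) hdist, fun hk => ?_⟩
  have h1 := hltn hk y hy q.muA q.muB
  have h2 := penLogLik_le_logLik (design x n k) y q.muA q.muB
  linarith

/-- The data-generating parameters are a parameter of the true model. -/
lemma linPred_design_true (x : ℕ → Fin p → ℝ) (a₀ : ℝ) {b₀ : Fin p → ℝ} (n : ℕ)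
    {k₀ : Finset (Fin p)} (hk₀ : ∀ j, j ∈ k₀ ↔ b₀ j ≠ 0) :
    linPred (design x n k₀) (centeredIntercept x a₀ b₀ n) (fun j => b₀ j) =
        trueLinPred x a₀ b₀ n ∧
      paramDist x a₀ b₀ n k₀ (centeredIntercept x a₀ b₀ n) (fun j => b₀ j) = 0 := by
  have h : extendZero k₀ (fun j => b₀ j) = b₀ := by
    ext j
    by_cases hj : j ∈ k₀
    · simp [extendZero, hj]
    · rw [extendZero_of_notMem _ hj]
      by_contra h
      exact hj ((hk₀ j).2 (Ne.symm h))
  refine ⟨?_, by simp [paramDist, h]⟩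
  ext i
  rw [linPred_design, trueLinPred_eq, h]

lemma GoodFit.le_penLogLik {x : ℕ → Fin p → ℝ} {a₀ : ℝ} {b₀ : Fin p → ℝ} {k₀ : Finset (Fin p)}
    (hk₀ : ∀ j, j ∈ k₀ ↔ b₀ j ≠ 0) {L D : ℝ} (hL0 : 0 ≤ L) {n : ℕ} (hn : 0 < n)
    (hL : ∑ i : Fin n, ∑ j, x i j ^ 2 ≤ L * n) {y : Fin n → Bool} {q : VBParams k₀} {D₀ : ℝ}
    (h : GoodFit x a₀ b₀ k₀ D₀ D y k₀ q) :
    logLik y (trueLinPred x a₀ b₀ n) - 2 * L * ∑ j, |b₀ j| ^ 2 ≤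
      penLogLik n (design x n k₀) y q.muA q.muB := by
  obtain ⟨h1, h2⟩ := linPred_design_true x a₀ n hk₀
  refine le_trans ?_ (h.isMax (centeredIntercept x a₀ b₀ n) fun j => b₀ j)
  have h3 := ProbitVBC.penalty_le hL0 hn hL h2.le
  simp only [zero_add] at h3
  rw [penLogLik, h1]
  linarith

/-- The criterion is the BIC up to the penalty and bounded terms. -/
lemma GoodFit.abs_log_pVBC_sub_le {x : ℕ → Fin p → ℝ} {a₀ : ℝ} {b₀ : Fin p → ℝ}
    {k k₀ : Finset (Fin p)} {D₀ D c : ℝ} (hc : 0 < c) {n : ℕ} (hn : 0 < n) {y : Fin n → Bool}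
    {q : VBParams k} (h : GoodFit x a₀ b₀ k₀ D₀ D y k q) :
    |Real.log (pVBC c n (design x n k) y q) -
      (Real.log (probitLik (design x n k) y q.muA q.muB) -
        ((k.card : ℝ) + 1) / 2 * Real.log n)| ≤
      D + |Real.log c| + Real.log (2 * Real.pi) / 2 + (k.card : ℝ) / 2 * Real.log 2 := by
  have hn1 : (1 : ℝ) ≤ n := by exact_mod_cast hn
  have hn' : (0 : ℝ) < n := by linarith
  have hlog : Real.log n ≤ Real.log (1 + n) := Real.log_le_log hn' (by linarith)
  have hlog2 : Real.log (1 + n) ≤ Real.log 2 + Real.log n := by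
    rw [← Real.log_mul two_ne_zero hn'.ne']
    exact Real.log_le_log (by linarith) (by linarith)
  have hpi : 0 ≤ Real.log (2 * Real.pi) := Real.log_nonneg (by linarith [Real.pi_gt_three])
  have hk : 0 ≤ (k.card : ℝ) / 2 := by positivity
  have hpen0 : 0 ≤ (design x n k *ᵥ q.muB) ⬝ᵥ (design x n k *ᵥ q.muB) / (2 * n) :=
    div_nonneg (Finset.sum_nonneg fun _ _ => mul_self_nonneg _) (by positivity)
  have h1 := mul_le_mul_of_nonneg_left hlog hk
  have h2 := mul_le_mul_of_nonneg_left hlog2 hk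
  have h3 := h.penalty_le
  have h4 := abs_le.1 (le_refl |Real.log c|)
  have h5 : 0 ≤ (k.card : ℝ) / 2 * Real.log 2 := mul_nonneg hk (Real.log_nonneg one_le_two)
  rw [log_pVBC hc hn ((h.unique q).2 rfl), log_probitLik, penLogLik, Fintype.card_coe, abs_le]
  constructor <;> linarith [h4.1, h4.2]

lemma GoodFit.VBC_lt {x : ℕ → Fin p → ℝ} {a₀ : ℝ} {b₀ : Fin p → ℝ} {k k₀ : Finset (Fin p)}
    (hk₀ : ∀ j, j ∈ k₀ ↔ b₀ j ≠ 0) (hk : k ≠ k₀) {L D D' c : ℝ} (hc : 0 < c) (hL0 : 0 ≤ L) {n : ℕ}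
    (hn : 0 < n) (hL : ∑ i : Fin n, ∑ j, x i j ^ 2 ≤ L * n) {y : Fin n → Bool}
    {q : VBParams k} {q₀ : VBParams k₀}
    (h : GoodFit x a₀ b₀ k₀ (2 * L * ∑ j, |b₀ j| ^ 2) D y k q)
    (h₀ : GoodFit x a₀ b₀ k₀ (2 * L * ∑ j, |b₀ j| ^ 2) D' y k₀ q₀) :
    VBC c n (design x n k₀) y q₀ < VBC c n (design x n k) y q := by
  have h1 := h.lt_of_ne hk
  have h2 := h₀.le_penLogLik hk₀ hL0 hn hL
  rw [VBC, VBC, log_pVBC hc hn ((h.unique q).2 rfl), log_pVBC hc hn ((h₀.unique q₀).2 rfl),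
    Fintype.card_coe, Fintype.card_coe]
  linarith

end Comparison

/-! ### The score is of order `√n` in probability -/

section Score

/-- The score of an observation with linear predictor `h` as a function of its latent error. -/
def errorScore (h e : ℝ) : ℝ := if 0 < h + e then mills h else -mills (-h)

lemma measurable_errorScore (h : ℝ) : Measurable (errorScore h) :=
  Measurable.ite (measurableSet_lt measurable_const (by fun_prop)) measurable_const
    measurable_const

lemma abs_errorScore_le (h e : ℝ) : |errorScore h e| ≤ mills h + mills (-h) := by
  have h1 := mills_pos h
  have h2 := mills_pos (-h)
  rw [errorScore]
  split_ifs
  · rw [abs_of_pos h1]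
    linarith
  · rw [abs_neg, abs_of_pos h2]
    linarith

lemma integral_ite_gaussianReal (h u v : ℝ) :
    ∫ e, (if 0 < h + e then u else v) ∂(gaussianReal 0 1) = u * Phi h + v * Phi (-h) := by
  have e1 : ∀ e, (if 0 < h + e then u else v) =
      (Set.Iic (-h)).indicator (fun _ => v) e + ((Set.Iic (-h))ᶜ).indicator (fun _ => u) e :=
    fun e => by
      by_cases he : 0 < h + e
      · have h1 : e ∉ Set.Iic (-h) := by
          simp only [Set.mem_Iic, not_le]
          linarith
        rw [if_pos he, Set.indicator_of_notMem h1, Set.indicator_of_mem (Set.mem_compl h1), zero_add]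
      · have h1 : e ∈ Set.Iic (-h) := by
          simp only [Set.mem_Iic]
          linarith
        rw [if_neg he, Set.indicator_of_mem h1,
          Set.indicator_of_notMem (Set.notMem_compl_iff.2 h1), add_zero]
  have h2 : (gaussianReal 0 1).real (Set.Iic (-h)) = Phi (-h) := by rw [Phi, cdf_eq_real]
  have h3 : (gaussianReal 0 1).real (Set.Iic (-h))ᶜ = Phi h := by
    rw [probReal_compl_eq_one_sub measurableSet_Iic, h2, Phi_neg]
    ring
  simp only [e1]
  rw [integral_add ((integrable_const v).indicator measurableSet_Iic)
    ((integrable_const u).indicator measurableSet_Iic.compl),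
    integral_indicator_const _ measurableSet_Iic, integral_indicator_const _ measurableSet_Iic.compl,
    h2, h3, smul_eq_mul, smul_eq_mul]
  ring

lemma integral_errorScore (h : ℝ) : ∫ e, errorScore h e ∂(gaussianReal 0 1) = 0 := by
  have h1 : ∀ t, mills t * Phi t = gaussianPDFReal 0 1 t := fun t =>
    div_mul_cancel₀ _ (Phi_pos t).ne'
  simp only [errorScore]
  rw [integral_ite_gaussianReal, neg_mul, h1, h1, gaussianPDFReal_even]
  ring

lemma exists_integral_errorScore_sq_le :
    ∃ V : ℝ, 0 < V ∧ ∀ h, ∫ e, errorScore h e ^ 2 ∂(gaussianReal 0 1) ≤ V := by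
  obtain ⟨V, hV0, hV⟩ := exists_gaussianPDFReal_mul_mills_le
  refine ⟨V + V, by positivity, fun h => ?_⟩
  have h1 : ∀ t, mills t ^ 2 * Phi t = gaussianPDFReal 0 1 t * mills t := fun t => by
    have := (Phi_pos t).ne'
    rw [mills]
    field_simp
  have h2 : ∀ e, errorScore h e ^ 2 = if 0 < h + e then mills h ^ 2 else mills (-h) ^ 2 :=
    fun e => by
      rw [errorScore]
      split_ifs <;> simp
  simp only [h2]
  rw [integral_ite_gaussianReal, h1, h1]
  exact add_le_add (hV h) (hV (-h))

variable {Ω : Type*} [MeasurableSpace Ω] {P : Measure Ω} [IsProbabilityMeasure P] {ε : ℕ → Ω → ℝ}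

lemma memLp_errorScore (hεm : ∀ i, Measurable (ε i)) (h : ℝ) (i : ℕ) (w : ℝ) :
    MemLp (fun ω => errorScore h (ε i ω) * w) 2 P := by
  refine MemLp.of_bound (((measurable_errorScore h).comp (hεm i)).mul_const w).aestronglyMeasurable
    ((mills h + mills (-h)) * |w|) (Eventually.of_forall fun ω => ?_)
  rw [Real.norm_eq_abs, abs_mul]
  gcongr
  exact abs_errorScore_le _ _

/-- Weighted sums of the independent centered scores have variance of the order of the sum of the
squared weights. -/
lemma integral_sum_errorScore_sq_le (hεm : ∀ i, Measurable (ε i))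
    (hεlaw : ∀ i, P.map (ε i) = gaussianReal 0 1) (hεind : iIndepFun ε P) {V : ℝ}
    (hV : ∀ h, ∫ e, errorScore h e ^ 2 ∂(gaussianReal 0 1) ≤ V) {n : ℕ} (h w : Fin n → ℝ) :
    ∫ ω, (∑ i : Fin n, errorScore (h i) (ε i ω) * w i) ^ 2 ∂P ≤ V * ∑ i, w i ^ 2 := by
  have hmap : ∀ (i : ℕ) {f : ℝ → ℝ}, Measurable f →
      ∫ ω, f (ε i ω) ∂P = ∫ e, f e ∂(gaussianReal 0 1) := fun i f hf => by
    rw [← hεlaw i, integral_map (hεm i).aemeasurable hf.aestronglyMeasurable]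
  set Y : Fin n → Ω → ℝ := fun i ω => errorScore (h i) (ε i ω) * w i with hY
  have hL : ∀ i, MemLp (Y i) 2 P := fun i => memLp_errorScore hεm _ _ _
  have hmean : ∀ i, ∫ ω, Y i ω ∂P = 0 := fun i => by
    simp only [hY]
    rw [integral_mul_const, hmap i (measurable_errorScore (h i)), integral_errorScore, zero_mul]
  have hvar : ∀ i, Var[Y i; P] ≤ V * w i ^ 2 := fun i => by
    rw [variance_of_integral_eq_zero (hL i).aemeasurable (hmean i)]
    simp only [hY, mul_pow]
    rw [integral_mul_const, hmap i ((measurable_errorScore (h i)).pow_const 2)]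
    exact mul_le_mul_of_nonneg_right (hV (h i)) (sq_nonneg _)
  have hind : ((Finset.univ : Finset (Fin n)) : Set (Fin n)).Pairwise
      fun i j => IndepFun (Y i) (Y j) P := fun i _ j _ hij =>
    (hεind.indepFun (fun hv => hij (Fin.ext hv))).comp
      ((measurable_errorScore (h i)).mul_const (w i))
      ((measurable_errorScore (h j)).mul_const (w j))
  have hsum := IndepFun.variance_sum (fun i _ => hL i) hind
  have hLs : MemLp (∑ i, Y i) 2 P := memLp_finsetSum' _ fun i _ => hL i
  have hmeans : ∫ ω, (∑ i, Y i) ω ∂P = 0 := by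
    simp only [Finset.sum_apply]
    rw [integral_finsetSum _ fun i _ => (hL i).integrable one_le_two]
    exact Finset.sum_eq_zero fun i _ => hmean i
  rw [variance_of_integral_eq_zero hLs.aemeasurable hmeans] at hsum
  simp only [Finset.sum_apply] at hsum
  rw [hsum, Finset.mul_sum]
  exact Finset.sum_le_sum fun i _ => hvar i

lemma integrable_sum_errorScore_sq (hεm : ∀ i, Measurable (ε i)) {n : ℕ} (h w : Fin n → ℝ) :
    Integrable (fun ω => (∑ i : Fin n, errorScore (h i) (ε i ω) * w i) ^ 2) P :=
  (memLp_finsetSum Finset.univ fun i _ => memLp_errorScore hεm (h i) i (w i)).integrable_sq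

variable {p : ℕ}

lemma score_outcomes (x : ℕ → Fin p → ℝ) (a₀ : ℝ) (b₀ : Fin p → ℝ) (n : ℕ) (e : ℕ → ℝ) (i : Fin n) :
    score (outcomes x a₀ b₀ e n) (trueLinPred x a₀ b₀ n) i =
      errorScore (trueLinPred x a₀ b₀ n i) (e i) := by
  by_cases h : 0 < a₀ + ∑ j, x i j * b₀ j + e i
  · simp [score, outcomes, errorScore, outcomeSign, trueLinPred, h]
  · simp [score, outcomes, errorScore, outcomeSign, trueLinPred, h]

/-- Chebyshev's inequality for the score at the true parameters. -/
lemma exists_prob_scoreSq_le {x : ℕ → Fin p → ℝ} (a₀ : ℝ) (b₀ : Fin p → ℝ)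
    (hεm : ∀ i, Measurable (ε i)) (hεlaw : ∀ i, P.map (ε i) = gaussianReal 0 1)
    (hεind : iIndepFun ε P) (hUI : SqUniformlyIntegrable x) {δ : ℝ} (hδ : 0 < δ) :
    ∃ C : ℝ, 0 ≤ C ∧ ∀ n : ℕ, 0 < n → 1 - δ ≤ P.real {ω | scoreSq x n
      (score (outcomes x a₀ b₀ (fun i => ε i ω) n) (trueLinPred x a₀ b₀ n)) ≤ C ^ 2 * n} := by
  obtain ⟨L, hL0, hL⟩ := exists_sum_sq_le hUI
  obtain ⟨V, hV0, hV⟩ := exists_integral_errorScore_sq_le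
  refine ⟨√(V * (1 + 4 * L) / δ), Real.sqrt_nonneg _, fun n hn => ?_⟩
  have hn' : (0 : ℝ) < n := by exact_mod_cast hn
  rw [Real.sq_sqrt (by positivity)]
  set S : Ω → ℝ := fun ω => scoreSq x n
    (score (outcomes x a₀ b₀ (fun i => ε i ω) n) (trueLinPred x a₀ b₀ n))
  set t := V * (1 + 4 * L) / δ * n
  have ht : 0 < t := by positivity
  have hS : S = fun ω =>
      (∑ i : Fin n, errorScore (trueLinPred x a₀ b₀ n i) (ε i ω) * 1) ^ 2 +
      ∑ j, (∑ i : Fin n, errorScore (trueLinPred x a₀ b₀ n i) (ε i ω) * centered x n i j) ^ 2 := by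
    ext ω
    simp only [S, scoreSq, score_outcomes, mul_one]
  have hint1 := integrable_sum_errorScore_sq (P := P) hεm (trueLinPred x a₀ b₀ n) fun _ => 1
  have hint2 := fun j => integrable_sum_errorScore_sq (P := P) hεm (trueLinPred x a₀ b₀ n)
    fun i => centered x n i j
  have hSint : Integrable S P := by
    rw [hS]
    exact hint1.add (integrable_finsetSum _ fun j _ => hint2 j)
  have hmean : ∫ ω, S ω ∂P ≤ δ * t := by
    have h1 := integral_sum_errorScore_sq_le hεm hεlaw hεind hV (trueLinPred x a₀ b₀ n) fun _ => 1
    have h2 := fun j => integral_sum_errorScore_sq_le hεm hεlaw hεind hV (trueLinPred x a₀ b₀ n)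
      fun i => centered x n i j
    have h3 : ∑ j, ∑ i, centered x n i j ^ 2 ≤ 4 * L * n := by
      rw [Finset.sum_comm]
      calc ∑ i, ∑ j, centered x n i j ^ 2 ≤ ∑ i : Fin n, (2 * ∑ j, x i j ^ 2 + 2 * L) :=
            Finset.sum_le_sum fun i _ => sum_centered_sq_le hL0 (hL n) i
        _ = 2 * ∑ i : Fin n, ∑ j, x i j ^ 2 + n * (2 * L) := by
            rw [Finset.sum_add_distrib, ← Finset.mul_sum]
            simp
        _ ≤ 4 * L * n := by linarith [hL n]
    rw [hS, integral_add hint1 (integrable_finsetSum _ fun j _ => hint2 j),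
      integral_finsetSum _ fun j _ => hint2 j]
    calc _ ≤ V * ∑ i : Fin n, (1 : ℝ) ^ 2 + ∑ j, V * ∑ i, centered x n i j ^ 2 :=
          add_le_add h1 (Finset.sum_le_sum fun j _ => h2 j)
      _ = V * (n + ∑ j, ∑ i, centered x n i j ^ 2) := by
          rw [← Finset.mul_sum]
          simp
          ring
      _ ≤ V * (n + 4 * L * n) := by gcongr
      _ = δ * t := by
          simp only [t]
          field_simp
  have hmarkov := mul_meas_ge_le_integral_of_nonneg (μ := P) (f := S)
    (Eventually.of_forall fun ω => by
      simp only [S, scoreSq, Pi.zero_apply]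
      positivity) hSint t
  have hge : P.real {ω | t ≤ S ω} ≤ δ := by
    have := hmarkov.trans hmean
    rw [mul_comm δ t] at this
    exact le_of_mul_le_mul_left this ht
  have hcover : P.real (Set.univ : Set Ω) ≤ P.real {ω | S ω ≤ t} + P.real {ω | t ≤ S ω} := by
    refine (measureReal_mono fun ω _ => ?_).trans (measureReal_union_le _ _)
    exact le_total (S ω) t
  rw [probReal_univ] at hcover
  have : 1 - δ ≤ P.real {ω | S ω ≤ t} := by linarith
  exact this

end Score

end

end ProbitVBC

theorem proposition6
    {Ω : Type*} [MeasurableSpace Ω] (P : Measure Ω) [IsProbabilityMeasure P]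
    -- covariates, true parameters, true model and candidate models
    {p : ℕ} (x : ℕ → Fin p → ℝ) (a₀ : ℝ) (b₀ : Fin p → ℝ)
    (k₀ : Finset (Fin p)) (hk₀ : ∀ j, j ∈ k₀ ↔ b₀ j ≠ 0)
    (M : Finset (Finset (Fin p))) (hk₀M : k₀ ∈ M)
    -- constant of the flat prior on the intercept
    (c : ℝ) (hc : 0 < c)
    -- independent standard normal latent errors
    (ε : ℕ → Ω → ℝ) (hεm : ∀ i, Measurable (ε i))
    (hεlaw : ∀ i, P.map (ε i) = gaussianReal 0 1) (hεind : iIndepFun ε P)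
    -- moment condition: the squared norms of the covariates are uniformly integrable
    (hUI : ∀ δ : ℝ, 0 < δ → ∃ B : ℝ, ∀ n : ℕ,
      (∑ i ∈ Finset.range n, if B < ∑ j, x i j ^ 2 then ∑ j, x i j ^ 2 else 0) ≤ δ * n)
    -- identification: the Gram matrices are asymptotically nondegenerate
    (hGram : ∀ k ∈ M, ∃ r : ℝ, 0 < r ∧ ∀ᶠ n : ℕ in atTop, ∀ v : ↥(k ∪ k₀) → ℝ,
      r * n * (v ⬝ᵥ v) ≤
        (ProbitVBC.design x n (k ∪ k₀) *ᵥ v) ⬝ᵥ (ProbitVBC.design x n (k ∪ k₀) *ᵥ v)) :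
    -- the Gaussian / truncated Gaussian ratio at the evaluation point is the probit likelihood
    (∀ (n : ℕ) (k : Finset (Fin p)) (y : Fin n → Bool) (q : ProbitVBC.VBParams k),
      ProbitVBC.obsLik y (ProbitVBC.zhat (ProbitVBC.design x n k) y q) *
          ProbitVBC.latentDensity (ProbitVBC.design x n k) q.muA q.muB
            (ProbitVBC.zhat (ProbitVBC.design x n k) y q) /
          ProbitVBC.qz (ProbitVBC.design x n k) y q
            (ProbitVBC.zhat (ProbitVBC.design x n k) y q) =
        ProbitVBC.probitLik (ProbitVBC.design x n k) y q.muA q.muB) ∧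
    -- the criterion has the form of the BIC, up to a term that is bounded in probability
    (∀ k ∈ M, ∀ δ : ℝ, 0 < δ → ∃ C : ℝ, ∀ᶠ n : ℕ in atTop,
      1 - δ ≤ P.real {ω | ∃ q : ProbitVBC.VBParams k,
        ProbitVBC.IsVBSolution (n : ℝ) (ProbitVBC.design x n k)
          (ProbitVBC.outcomes x a₀ b₀ (fun i => ε i ω) n) q ∧
        |Real.log (ProbitVBC.pVBC c n (ProbitVBC.design x n k)
            (ProbitVBC.outcomes x a₀ b₀ (fun i => ε i ω) n) q) -
          (Real.log (ProbitVBC.probitLik (ProbitVBC.design x n k)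
              (ProbitVBC.outcomes x a₀ b₀ (fun i => ε i ω) n) q.muA q.muB) -
            ((k.card : ℝ) + 1) / 2 * Real.log n)| ≤ C}) ∧
    -- with probability tending to one, all candidates have a unique variational solution and
    -- the true model is the unique minimizer of the criterion
    Tendsto (fun n : ℕ => P.real {ω | ∃ q : (k : Finset (Fin p)) → ProbitVBC.VBParams k,
        (∀ k ∈ M, ∀ q' : ProbitVBC.VBParams k,
          ProbitVBC.IsVBSolution (n : ℝ) (ProbitVBC.design x n k)
            (ProbitVBC.outcomes x a₀ b₀ (fun i => ε i ω) n) q' ↔ q' = q k) ∧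
        ProbitVBC.argminSet M (fun k => ProbitVBC.VBC c n (ProbitVBC.design x n k)
          (ProbitVBC.outcomes x a₀ b₀ (fun i => ε i ω) n) (q k)) = {k₀}})
      atTop (𝓝 1) := by
  have hUI' : ProbitVBC.SqUniformlyIntegrable x := hUI
  obtain ⟨L, hL0, hL⟩ := ProbitVBC.exists_sum_sq_le hUI'
  have hfit : ∀ k ∈ M, ∃ D : ℝ, ∀ C : ℝ, 0 ≤ C → ∀ᶠ n : ℕ in atTop, ∀ y : Fin n → Bool,
      ProbitVBC.scoreSq x n (ProbitVBC.score y (ProbitVBC.trueLinPred x a₀ b₀ n)) ≤ C ^ 2 * n →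
      ∃ q : ProbitVBC.VBParams k,
        ProbitVBC.GoodFit x a₀ b₀ k₀ (2 * L * ∑ j, |b₀ j| ^ 2) D y k q := fun k hk => by
    obtain ⟨r, hr, hG⟩ := hGram k hk
    exact ProbitVBC.exists_goodFit a₀ hUI' hk₀ hr hG _
  refine ⟨fun n k y q => ProbitVBC.obsLik_mul_latentDensity_div_qz _ y q, fun k hk δ hδ => ?_, ?_⟩
  · obtain ⟨D, hD⟩ := hfit k hk
    obtain ⟨C, hC0, hC⟩ := ProbitVBC.exists_prob_scoreSq_le a₀ b₀ hεm hεlaw hεind hUI' hδ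
    refine ⟨D + |Real.log c| + Real.log (2 * Real.pi) / 2 + (k.card : ℝ) / 2 * Real.log 2, ?_⟩
    filter_upwards [hD C hC0, eventually_gt_atTop 0] with n hn hn0
    refine (hC n hn0).trans (measureReal_mono fun ω hω => ?_)
    obtain ⟨q, hq⟩ := hn _ hω
    exact ⟨q, (hq.unique q).2 rfl, hq.abs_log_pVBC_sub_le hc hn0⟩
  · refine tendsto_order.2 ⟨fun s hs => ?_, fun s hs =>
      Eventually.of_forall fun n => measureReal_le_one.trans_lt hs⟩
    obtain ⟨C, hC0, hC⟩ := ProbitVBC.exists_prob_scoreSq_le a₀ b₀ hεm hεlaw hεind hUI'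
      (half_pos (sub_pos.2 hs))
    choose! D hD using hfit
    have hall := (eventually_all_finset M).2 fun k hk => hD k hk C hC0
    filter_upwards [hall, eventually_gt_atTop 0] with n hn hn0
    refine lt_of_lt_of_le (by linarith) ((hC n hn0).trans (measureReal_mono fun ω hω => ?_))
    -- outside `M` the choice of `q` is irrelevant
    have hex : ∀ k : Finset (Fin p), ∃ q : ProbitVBC.VBParams k, k ∈ M →
        ProbitVBC.GoodFit x a₀ b₀ k₀ (2 * L * ∑ j, |b₀ j| ^ 2) (D k)
          (ProbitVBC.outcomes x a₀ b₀ (fun i => ε i ω) n) k q := fun k => by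
      by_cases hk : k ∈ M
      · obtain ⟨q, hq⟩ := hn k hk _ hω
        exact ⟨q, fun _ => hq⟩
      · exact ⟨⟨0, 0, 0, 0⟩, fun h => absurd h hk⟩
    choose q hq using hex
    refine ⟨q, fun k hk => (hq k hk).unique, ?_⟩
    have hlt : ∀ k ∈ M, k ≠ k₀ →
        ProbitVBC.VBC c n (ProbitVBC.design x n k₀)
          (ProbitVBC.outcomes x a₀ b₀ (fun i => ε i ω) n) (q k₀) <
        ProbitVBC.VBC c n (ProbitVBC.design x n k)
          (ProbitVBC.outcomes x a₀ b₀ (fun i => ε i ω) n) (q k) := fun k hk hne =>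
      (hq k hk).VBC_lt hk₀ hne hc hL0 hn0 (hL n) (hq k₀ hk₀M)
    ext k
    refine ⟨fun h => ?_, ?_⟩
    · by_contra hne
      exact absurd (h.2 k₀ hk₀M) (not_le.2 (hlt k h.1 hne))
    · rintro rfl
      refine ⟨hk₀M, fun l hl => ?_⟩
      by_cases hne : l = k
      · rw [hne]
      · exact (hlt l hl hne).le
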